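/- Let $L=\sqrt2\,\mathbb Z\times 2\mathbb Z\subset\mathbb C$ (that is, $\sqrt2\,\mathbb Z+2i\,\mathbb Z$), let $S^2=\mathbb C/\!\sim$ with $z\sim w$ iff $w\in \pm z+L$ (a topological $2$-sphere, two rectangles $[0,\sqrt2/2]\times[0,1]$ glued along their boundaries), let $\wp\colon\mathbb C\to S^2$ be the quotient map, $\psi(z)=\sqrt2\,i\,z$, and let $h\colon S^2\to S^2$ be the degree-$2$ Lattès map determined by $h\circ\wp=\wp\circ\psi$. A point is critical for $h$ if near it $h$ is, in local topological coordinates of source and target, $z\mapsto z^q$ with $q\ge 2$; $\operatorname{post}(h)=\bigcup_{n\ge1}h^n(\operatorname{crit}(h))$. Let $\mathcal C\supset\operatorname{post}(h)$ be an oriented Jordan curve, parametrized by an injective continuous map $g\colon \mathbb R/\mathbb Z\to S^2$ with image $\mathcal C$. For $n\ge 0$ let $V^n=h^{-n}(\operatorname{post}(h))$ be the set of $n$-vertices; an $n$-edge is the closure of a component of $h^{-n}(\mathcal C)\setminus V^n$; an oriented $n$-edge is an $n$-edge whose two end points are labelled as initial and terminal point. An Eulerian circuit of $n$-edges is a cyclic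 sequence of oriented $n$-edges in which each $n$-edge appears exactly once and the terminal point of each is the initial point of the next. A closed curve $\mathbb R/\mathbb Z\to S^2$ traverses such a circuit $E_0,\dots,E_{M-1}$ if it is continuous and the circle can be divided cyclically into arcs that the curve maps homeomorphically and orientation-preservingly onto $E_0,\dots,E_{M-1}$. A circuit $\gamma^1=(E'_0,\dots,E'_{2N-1})$ of $1$-edges is a $2$-fold cover of a circuit $\gamma^0=(E_0,\dots,E_{N-1})$ of $0$-edges by $h$ if for some $m$ we have $h(E'_j)=E_{m+j}$ as oriented edges for all $j$ (indices cyclic). An initial pseudo-isotopy for $\mathcal C$ is a continuous map $H\colon S^2\times[0,1]\to S^2$, $H_t=H(\cdot,t)$, such that 1. $H_0=\mathrm{id}$, $H_t$ is a homeomorphism for every $t<1$, and $H_t(p)=p$ for all $p\in\operatorname{post}(h)$ and all $t$; 2. $H_1$ maps the union of all $0$-edges ($=\mathcal C$) onto the union of all $1$-edges ($=h^{-1}(\mathcal C)$); 3. for every open $V\supset V^1$ there is $\varepsilon>0$ such that $H_t(x)=H_1(x)$ for all $x\notin V$ and $t\in[1-\varepsilon,1]$; 4. for every $v\in V^1$ the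 set $\{x\in\mathcal C: H_1(x)=v\}$ is finite; 5. $g$ traverses an Eulerian circuit of $0$-edges, $H_1\circ g$ traverses an Eulerian circuit of $1$-edges, and the latter is a $2$-fold cover of the former by $h$. Then, for every such $\mathcal C$ and $g$: let $\gamma^0$ be the Eulerian circuit of $0$-edges traversed by $g$, and let $\gamma^1$ be any Eulerian circuit of $1$-edges that is a $2$-fold cover of $\gamma^0$ by $h$. There is no initial pseudo-isotopy $H$ for $\mathcal C$ that deforms $\gamma^0$ to $\gamma^1$, i.e. such that $H_1\circ g$ traverses $\gamma^1$. In particular, there is no initial pseudo-isotopy for $\mathcal C$ at all. -/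

import Mathlib

/-! ### The sphere as a pillow and the Lattès map `h` -/

/-- The lattice `L = √2 ℤ × 2 ℤ ⊂ ℂ`. -/
def lattesLattice : AddSubgroup ℂ where
  carrier := {z | ∃ m n : ℤ, z = (m : ℂ) * (Real.sqrt 2 : ℂ) + (n : ℂ) * (2 * Complex.I)}
  zero_mem' := ⟨0, 0, by simp⟩
  add_mem' := by
    rintro _ _ ⟨m, n, rfl⟩ ⟨m', n', rfl⟩
    exact ⟨m + m', n + n', by push_cast; ring⟩
  neg_mem' := by
    rintro _ ⟨m, n, rfl⟩
    exact ⟨-m, -n, by push_cast; ring⟩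

/-- Two points of the plane are identified iff they agree up to sign modulo `L`. -/
def pillowSetoid : Setoid ℂ where
  r z w := w - z ∈ lattesLattice ∨ w + z ∈ lattesLattice
  iseqv :=
    { refl := fun z => Or.inl (by simp [lattesLattice.zero_mem])
      symm := by
        rintro z w (h | h)
        · exact Or.inl (by simpa using lattesLattice.neg_mem h)
        · exact Or.inr (by simpa [add_comm] using h)
      trans := by
        rintro x y z (h | h) (h' | h')
        · exact Or.inl (by convert lattesLattice.add_mem h h' using 1; ring)
        · exact Or.inr (by convert lattesLattice.sub_mem h' h using 1; ring)
        · exact Or.inr (by convert lattesLattice.add_mem h h' using 1; ring)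
        · exact Or.inl (by convert lattesLattice.sub_mem h' h using 1; ring) }

/-- The sphere `S² = ℂ / (z ∼ ± z + L)`, i.e. two rectangles `[0, √2/2] × [0, 1]` glued together
along their boundaries. It is a topological 2-sphere, see `pillow_homeomorph_sphere`. -/
def Pillow : Type := Quotient pillowSetoid

instance : TopologicalSpace Pillow := inferInstanceAs (TopologicalSpace (Quotient pillowSetoid))

/-- The orbifold covering `℘ : ℂ → S²`, an even map which is periodic with respect to `L`. -/
def pillowProj (z : ℂ) : Pillow := Quotient.mk pillowSetoid z

/-- The linear map `ψ(z) = √2 i z`. -/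
noncomputable def lattesLift (z : ℂ) : ℂ := (Real.sqrt 2 : ℂ) * Complex.I * z

theorem lattesLift_mem {z : ℂ} (hz : z ∈ lattesLattice) : lattesLift z ∈ lattesLattice := by
  obtain ⟨m, n, rfl⟩ := hz
  refine ⟨-2 * n, m, ?_⟩
  have h2 : (Real.sqrt 2 : ℂ) * (Real.sqrt 2 : ℂ) = 2 := by
    rw [← Complex.ofReal_mul, Real.mul_self_sqrt (by norm_num)]
    norm_num
  unfold lattesLift
  push_cast
  linear_combination (m : ℂ) * Complex.I * h2 + 2 * (n : ℂ) * (Real.sqrt 2 : ℂ) * Complex.I_mul_I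

/-- The Lattès map `h : S² → S²`, the map with `h ∘ ℘ = ℘ ∘ ψ`. -/
noncomputable def lattesMap : Pillow → Pillow :=
  Quotient.map lattesLift (by
    rintro z w (h | h)
    · left
      have := lattesLift_mem h
      convert this using 1
      unfold lattesLift
      ring
    · right
      have := lattesLift_mem h
      convert this using 1
      unfold lattesLift
      ring)

theorem lattesMap_pillowProj (z : ℂ) :
    lattesMap (pillowProj z) = pillowProj (lattesLift z) := rfl

/-! #### The pillow is a topological 2-sphere -/

theorem pillowProj_eq_iff (z w : ℂ) :
    pillowProj z = pillowProj w ↔ w - z ∈ lattesLattice ∨ w + z ∈ lattesLattice :=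
  Quotient.eq (r := pillowSetoid)

/-- A map from the plane to `ℝ³` that is `L`-periodic and even. -/
noncomputable def pillowSpace (z : ℂ) : EuclideanSpace ℝ (Fin 3) :=
  !₂[Real.cos (Real.sqrt 2 * Real.pi * z.re), Real.cos (Real.pi * z.im),
    Real.sin (Real.sqrt 2 * Real.pi * z.re) * Real.sin (Real.pi * z.im)]

theorem mem_lattesLattice_iff (z : ℂ) : z ∈ lattesLattice ↔
    (∃ m : ℤ, Real.sqrt 2 * Real.pi * z.re = 2 * m * Real.pi) ∧
      ∃ n : ℤ, Real.pi * z.im = 2 * n * Real.pi := by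
  have hπ := Real.pi_pos.ne'
  have h2 : Real.sqrt 2 * Real.sqrt 2 = 2 := Real.mul_self_sqrt (by norm_num)
  have h2' : Real.sqrt 2 ≠ 0 := by positivity
  constructor
  · rintro ⟨m, n, rfl⟩
    refine ⟨⟨m, ?_⟩, ⟨n, ?_⟩⟩
    · simp
      linear_combination Real.pi * (m : ℝ) * h2
    · simp
      ring
  · rintro ⟨⟨m, hm⟩, ⟨n, hn⟩⟩
    refine ⟨m, n, ?_⟩
    have h1 : z.re = m * Real.sqrt 2 := by
      apply mul_left_cancel₀ (mul_ne_zero h2' hπ)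
      linear_combination hm - Real.pi * (m : ℝ) * h2
    have h3 : z.im = n * 2 := by
      apply mul_left_cancel₀ hπ
      linear_combination hn
    apply Complex.ext <;> simp [h1, h3]

theorem cos_cos_sin_eq_iff (u v u' v' : ℝ) :
    (Real.cos u = Real.cos u' ∧ Real.cos v = Real.cos v' ∧
      Real.sin u * Real.sin v = Real.sin u' * Real.sin v') ↔
    ((∃ m : ℤ, u' - u = 2 * m * Real.pi) ∧ ∃ n : ℤ, v' - v = 2 * n * Real.pi) ∨
    ((∃ m : ℤ, u' + u = 2 * m * Real.pi) ∧ ∃ n : ℤ, v' + v = 2 * n * Real.pi) := by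
  constructor
  · rintro ⟨h1, h2, h3⟩
    obtain ⟨m, hm⟩ := Real.cos_eq_cos_iff.1 h1
    obtain ⟨n, hn⟩ := Real.cos_eq_cos_iff.1 h2
    have key : ∀ x y : ℝ, Real.sin x * Real.sin y = 0 →
        (∃ k : ℤ, x = k * Real.pi) ∨ ∃ k : ℤ, y = k * Real.pi := by
      intro x y h
      rcases mul_eq_zero.1 h with h | h
      · obtain ⟨k, hk⟩ := Real.sin_eq_zero_iff.1 h
        exact Or.inl ⟨k, hk.symm⟩
      · obtain ⟨k, hk⟩ := Real.sin_eq_zero_iff.1 h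
        exact Or.inr ⟨k, hk.symm⟩
    rcases hm with hm | hm <;> rcases hn with hn | hn
    · exact Or.inl ⟨⟨m, by linarith⟩, ⟨n, by linarith⟩⟩
    · have e1 : Real.sin u' = Real.sin u := by
        rw [hm, add_comm, show 2 * (m : ℝ) * Real.pi = m * (2 * Real.pi) by ring,
          Real.sin_add_int_mul_two_pi]
      have e2 : Real.sin v' = -Real.sin v := by
        rw [hn, show 2 * (n : ℝ) * Real.pi - v = -v + n * (2 * Real.pi) by ring,
          Real.sin_add_int_mul_two_pi, Real.sin_neg]
      rcases key u v (by rw [e1, e2] at h3; linarith) with ⟨k, hk⟩ | ⟨k, hk⟩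
      · exact Or.inr ⟨⟨m + k, by push_cast; linarith⟩, ⟨n, by linarith⟩⟩
      · exact Or.inl ⟨⟨m, by linarith⟩, ⟨n - k, by push_cast; linarith⟩⟩
    · have e1 : Real.sin v' = Real.sin v := by
        rw [hn, add_comm, show 2 * (n : ℝ) * Real.pi = n * (2 * Real.pi) by ring,
          Real.sin_add_int_mul_two_pi]
      have e2 : Real.sin u' = -Real.sin u := by
        rw [hm, show 2 * (m : ℝ) * Real.pi - u = -u + m * (2 * Real.pi) by ring,
          Real.sin_add_int_mul_two_pi, Real.sin_neg]
      rcases key u v (by rw [e1, e2] at h3; linarith) with ⟨k, hk⟩ | ⟨k, hk⟩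
      · exact Or.inl ⟨⟨m - k, by push_cast; linarith⟩, ⟨n, by linarith⟩⟩
      · exact Or.inr ⟨⟨m, by linarith⟩, ⟨n + k, by push_cast; linarith⟩⟩
    · exact Or.inr ⟨⟨m, by linarith⟩, ⟨n, by linarith⟩⟩
  · rintro (⟨⟨m, hm⟩, ⟨n, hn⟩⟩ | ⟨⟨m, hm⟩, ⟨n, hn⟩⟩)
    · have hu : u' = u + m * (2 * Real.pi) := by linarith
      have hv : v' = v + n * (2 * Real.pi) := by linarith
      rw [hu, hv]
      simp only [Real.sin_add_int_mul_two_pi, Real.cos_add_int_mul_two_pi, and_self]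
    · have hu : u' = -u + m * (2 * Real.pi) := by linarith
      have hv : v' = -v + n * (2 * Real.pi) := by linarith
      rw [hu, hv]
      simp [Real.sin_add_int_mul_two_pi, Real.cos_add_int_mul_two_pi]

theorem pillowSpace_eq_iff (z w : ℂ) :
    pillowSpace z = pillowSpace w ↔ pillowProj z = pillowProj w := by
  rw [pillowProj_eq_iff, mem_lattesLattice_iff, mem_lattesLattice_iff]
  simp only [Complex.sub_re, Complex.sub_im, Complex.add_re, Complex.add_im, mul_sub, mul_add]
  rw [← cos_cos_sin_eq_iff]
  constructor
  · intro h
    have h0 := congrArg (fun x : EuclideanSpace ℝ (Fin 3) => x 0) h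
    have h1 := congrArg (fun x : EuclideanSpace ℝ (Fin 3) => x 1) h
    have h2 := congrArg (fun x : EuclideanSpace ℝ (Fin 3) => x 2) h
    simp [pillowSpace] at h0 h1 h2
    exact ⟨h0, h1, h2⟩
  · rintro ⟨h0, h1, h2⟩
    unfold pillowSpace
    rw [h0, h1, h2]

theorem pillowSpace_rel (z : ℂ) : (pillowSpace z 0) ^ 2 ≤ 1 ∧ (pillowSpace z 1) ^ 2 ≤ 1 ∧
    (pillowSpace z 2) ^ 2 = (1 - (pillowSpace z 0) ^ 2) * (1 - (pillowSpace z 1) ^ 2) := by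
  simp only [pillowSpace]
  refine ⟨by simpa using Real.abs_cos_le_one _, by simpa using Real.abs_cos_le_one _, ?_⟩
  simp [mul_pow, Real.sin_sq]

theorem pillowSpace_ne_zero (z : ℂ) : pillowSpace z ≠ 0 := by
  intro h
  have := (pillowSpace_rel z).2.2
  rw [h] at this
  norm_num at this

theorem continuous_pillowSpace : Continuous pillowSpace := by
  unfold pillowSpace
  refine (PiLp.continuous_toLp 2 _).comp (continuous_pi fun i => ?_)
  fin_cases i
  · simp; fun_prop
  · simp; fun_prop
  · simp; fun_prop

theorem radial_unique {p q r t : ℝ} (ht : 1 < t) (hp : (t * p) ^ 2 ≤ 1) (hq : (t * q) ^ 2 ≤ 1)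
    (h : r ^ 2 = (1 - p ^ 2) * (1 - q ^ 2))
    (h' : (t * r) ^ 2 = (1 - (t * p) ^ 2) * (1 - (t * q) ^ 2)) : False := by
  have ht2 : 1 < t ^ 2 := by nlinarith
  rw [mul_pow] at hp hq
  simp only [mul_pow] at h'
  have hp1 : p ^ 2 < 1 := by nlinarith [sq_nonneg p]
  have hq1 : q ^ 2 < 1 := by nlinarith [sq_nonneg q]
  have hpos : 0 < r ^ 2 := by rw [h]; exact mul_pos (by linarith) (by linarith)
  have hle : (1 - t ^ 2 * p ^ 2) * (1 - t ^ 2 * q ^ 2) ≤ (1 - p ^ 2) * (1 - q ^ 2) := by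
    apply mul_le_mul
    · nlinarith [sq_nonneg p]
    · nlinarith [sq_nonneg q]
    · linarith
    · linarith
  nlinarith

theorem pillowSpace_radial {z w : ℂ} {t : ℝ} (ht : 0 < t)
    (h : pillowSpace w = t • pillowSpace z) : t = 1 := by
  have hz := pillowSpace_rel z
  have hw := pillowSpace_rel w
  rcases lt_trichotomy t 1 with hlt | heq | hgt
  · exfalso
    have h1 : pillowSpace z = t⁻¹ • pillowSpace w := by
      rw [h, smul_smul, inv_mul_cancel₀ ht.ne', one_smul]
    rw [h1] at hz
    simp only [PiLp.smul_apply, smul_eq_mul] at hz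
    exact radial_unique ((one_lt_inv₀ ht).2 hlt) hz.1 hz.2.1 hw.2.2 hz.2.2
  · exact heq
  · exfalso
    rw [h] at hw
    simp only [PiLp.smul_apply, smul_eq_mul] at hw
    exact radial_unique hgt hw.1 hw.2.1 hz.2.2 hw.2.2

theorem exists_pillowSpace {p q r : ℝ} (hp : p ^ 2 ≤ 1) (hq : q ^ 2 ≤ 1)
    (h : r ^ 2 = (1 - p ^ 2) * (1 - q ^ 2)) : ∃ z, pillowSpace z = !₂[p, q, r] := by
  have hp' := abs_le.1 ((sq_le_one_iff_abs_le_one p).1 hp)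
  have hq' := abs_le.1 ((sq_le_one_iff_abs_le_one q).1 hq)
  have h2' : Real.sqrt 2 ≠ 0 := by positivity
  have hπ := Real.pi_pos.ne'
  have main : ∃ u v : ℝ, Real.cos u = p ∧ Real.cos v = q ∧ Real.sin u * Real.sin v = r := by
    have hs : Real.sin (Real.arccos p) * Real.sin (Real.arccos q) = |r| := by
      rw [Real.sin_arccos, Real.sin_arccos, ← Real.sqrt_mul (by linarith), ← h, Real.sqrt_sq_eq_abs]
    rcases le_total 0 r with hr | hr
    · exact ⟨Real.arccos p, Real.arccos q, Real.cos_arccos hp'.1 hp'.2,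
        Real.cos_arccos hq'.1 hq'.2, by rw [hs, abs_of_nonneg hr]⟩
    · refine ⟨-Real.arccos p, Real.arccos q, ?_, Real.cos_arccos hq'.1 hq'.2, ?_⟩
      · rw [Real.cos_neg, Real.cos_arccos hp'.1 hp'.2]
      · rw [Real.sin_neg, neg_mul, hs, abs_of_nonpos hr, neg_neg]
  obtain ⟨u, v, hu, hv, huv⟩ := main
  refine ⟨⟨u / (Real.sqrt 2 * Real.pi), v / Real.pi⟩, ?_⟩
  unfold pillowSpace
  simp only
  rw [mul_div_cancel₀ u (mul_ne_zero h2' hπ), mul_div_cancel₀ v hπ, hu, hv, huv]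

theorem exists_radial {a b c : ℝ} (h : a ^ 2 + b ^ 2 + c ^ 2 = 1) :
    ∃ s : ℝ, 0 < s ∧ (s * a) ^ 2 ≤ 1 ∧ (s * b) ^ 2 ≤ 1 ∧
      (s * c) ^ 2 = (1 - (s * a) ^ 2) * (1 - (s * b) ^ 2) := by
  wlog hab : a ^ 2 ≤ b ^ 2 generalizing a b
  · have hba : b ^ 2 ≤ a ^ 2 := le_of_lt (not_le.1 hab)
    obtain ⟨s, h0, h1, h2, h3⟩ := @this b a (by linarith) hba
    exact ⟨s, h0, h2, h1, by rw [h3, mul_comm]⟩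
  by_cases hb : b = 0
  · subst hb
    have ha : a = 0 := by nlinarith [sq_nonneg a]
    subst ha
    exact ⟨1, by norm_num, by norm_num, by norm_num, by linarith⟩
  · have hb' : 0 < |b| := abs_pos.2 hb
    have hbb : (|b|⁻¹ * b) ^ 2 = 1 := by
      rw [mul_pow, inv_pow, sq_abs, inv_mul_cancel₀ (pow_ne_zero 2 hb)]
    have hcont : ContinuousOn
        (fun s : ℝ => (s * c) ^ 2 - (1 - (s * a) ^ 2) * (1 - (s * b) ^ 2)) (Set.Icc 0 |b|⁻¹) := by
      fun_prop
    have hivt := intermediate_value_Icc (by positivity) hcont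
    obtain ⟨s, ⟨hs0, hs1⟩, hs⟩ := hivt (show (0 : ℝ) ∈ _ from by
      constructor
      · norm_num
      · simp only [hbb]
        nlinarith [sq_nonneg (|b|⁻¹ * c)])
    simp only at hs
    have hs0' : s ≠ 0 := by
      rintro rfl
      norm_num at hs
    have hsb : (s * b) ^ 2 ≤ 1 := by
      rw [← hbb, mul_pow, mul_pow]
      gcongr
    refine ⟨s, lt_of_le_of_ne hs0 (Ne.symm hs0'), ?_, hsb, by linarith⟩
    refine le_trans ?_ hsb
    rw [mul_pow, mul_pow]
    gcongr

/-- The pillow is homeomorphic to the unit sphere of `ℝ³`. -/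
theorem pillow_homeomorph_sphere :
    Nonempty (Pillow ≃ₜ Metric.sphere (0 : EuclideanSpace ℝ (Fin 3)) 1) := by
  have hmk : Continuous pillowProj := continuous_quotient_mk'
  have hper : ∀ z : ℂ, ∃ w ∈ (Set.Icc 0 (Real.sqrt 2)) ×ℂ (Set.Icc 0 2),
      pillowProj w = pillowProj z := by
    intro z
    have h2 : 0 < Real.sqrt 2 := by positivity
    refine ⟨z - ((⌊z.re / Real.sqrt 2⌋ : ℤ) * (Real.sqrt 2 : ℂ) +
      (⌊z.im / 2⌋ : ℤ) * (2 * Complex.I)), ?_, ?_⟩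
    · have a1 := (le_div_iff₀ h2).1 (Int.floor_le (z.re / Real.sqrt 2))
      have a2 := (div_lt_iff₀ h2).1 (Int.lt_floor_add_one (z.re / Real.sqrt 2))
      have a3 := (le_div_iff₀ two_pos).1 (Int.floor_le (z.im / 2))
      have a4 := (div_lt_iff₀ two_pos).1 (Int.lt_floor_add_one (z.im / 2))
      rw [Complex.mem_reProdIm]
      simp
      refine ⟨⟨?_, ?_⟩, ⟨?_, ?_⟩⟩ <;> nlinarith
    · rw [pillowProj_eq_iff]
      exact Or.inl ⟨⌊z.re / Real.sqrt 2⌋, ⌊z.im / 2⌋, by ring⟩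
  have : CompactSpace Pillow := by
    constructor
    have : pillowProj '' ((Set.Icc 0 (Real.sqrt 2)) ×ℂ (Set.Icc 0 2)) = Set.univ := by
      rw [Set.eq_univ_iff_forall]
      intro x
      obtain ⟨z, rfl⟩ := Quotient.exists_rep x
      obtain ⟨w, hw, hwz⟩ := hper z
      exact ⟨w, hw, hwz⟩
    rw [← this]
    exact (isCompact_Icc.reProdIm isCompact_Icc).image hmk
  let N : ℂ → Metric.sphere (0 : EuclideanSpace ℝ (Fin 3)) 1 := fun z =>
    ⟨‖pillowSpace z‖⁻¹ • pillowSpace z, by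
      have := norm_ne_zero_iff.2 (pillowSpace_ne_zero z)
      rw [mem_sphere_zero_iff_norm, norm_smul, norm_inv, norm_norm, inv_mul_cancel₀ this]⟩
  have hN : Continuous N := by
    refine Continuous.subtype_mk ?_ _
    exact (continuous_pillowSpace.norm.inv₀ fun z => norm_ne_zero_iff.2 (pillowSpace_ne_zero z)).smul
      continuous_pillowSpace
  have hNN : ∀ z w, N z = N w ↔ pillowProj z = pillowProj w := by
    intro z w
    rw [← pillowSpace_eq_iff]
    have hz := norm_pos_iff.2 (pillowSpace_ne_zero z)
    have hw := norm_pos_iff.2 (pillowSpace_ne_zero w)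
    constructor
    · intro h
      have h1 : ‖pillowSpace z‖⁻¹ • pillowSpace z = ‖pillowSpace w‖⁻¹ • pillowSpace w :=
        congrArg Subtype.val h
      have h2 : pillowSpace w = (‖pillowSpace w‖ * ‖pillowSpace z‖⁻¹) • pillowSpace z := by
        rw [mul_smul, h1, smul_smul, mul_inv_cancel₀ hw.ne', one_smul]
      have h3 := pillowSpace_radial (by positivity) h2
      rw [h3, one_smul] at h2
      exact h2.symm
    · intro h
      apply Subtype.ext
      change ‖pillowSpace z‖⁻¹ • pillowSpace z = ‖pillowSpace w‖⁻¹ • pillowSpace w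
      rw [h]
  let Φ : Pillow → Metric.sphere (0 : EuclideanSpace ℝ (Fin 3)) 1 :=
    Quotient.lift N fun z w h => (hNN z w).2 (Quotient.sound h)
  have hΦ : Continuous Φ := hN.quotient_lift _
  have hbij : Function.Bijective Φ := by
    constructor
    · intro x y
      obtain ⟨z, rfl⟩ := Quotient.exists_rep x
      obtain ⟨w, rfl⟩ := Quotient.exists_rep y
      exact (hNN z w).1
    · rintro ⟨x, hx⟩
      rw [mem_sphere_zero_iff_norm] at hx
      have hx2 : x 0 ^ 2 + x 1 ^ 2 + x 2 ^ 2 = 1 := by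
        have := EuclideanSpace.norm_sq_eq x
        rw [hx, Fin.sum_univ_three] at this
        simpa using this.symm
      obtain ⟨s, hs, h1, h2, h3⟩ := exists_radial hx2
      obtain ⟨z, hz⟩ := exists_pillowSpace h1 h2 h3
      have hz' : pillowSpace z = s • x := by
        rw [hz]
        ext i
        fin_cases i <;> simp
      refine ⟨pillowProj z, ?_⟩
      apply Subtype.ext
      change ‖pillowSpace z‖⁻¹ • pillowSpace z = x
      rw [hz', norm_smul, hx, mul_one, Real.norm_of_nonneg hs.le, smul_smul,
        inv_mul_cancel₀ hs.ne', one_smul]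
  exact ⟨Continuous.homeoOfEquivCompactToT2 (f := Equiv.ofBijective Φ hbij) hΦ⟩

/-! ### Branched covers of the sphere: critical and postcritical points, vertices, edges -/

section General

variable {S : Type*} [TopologicalSpace S]

/-- `f` has local degree `q` at `v`: in suitable topological coordinates around `v` and `f v`
it is the map `z ↦ z ^ q` of the unit disk. -/
def HasLocalDegree (f : S → S) (v : S) (q : ℕ) : Prop :=
  ∃ φ ψ : OpenPartialHomeomorph S ℂ,
    v ∈ φ.source ∧ φ v = 0 ∧ φ.target = Metric.ball 0 1 ∧
    f v ∈ ψ.source ∧ ψ (f v) = 0 ∧ ψ.target = Metric.ball 0 1 ∧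
    Set.MapsTo f φ.source ψ.source ∧ ∀ x ∈ φ.source, ψ (f x) = φ x ^ q

/-- The set of critical points. -/
def critSet (f : S → S) : Set S := {v | ∃ q : ℕ, 2 ≤ q ∧ HasLocalDegree f v q}

/-- The set of postcritical points `post(f) = ⋃_{n ≥ 1} fⁿ(crit(f))`. -/
def postSet (f : S → S) : Set S := ⋃ n : ℕ, ⋃ _ : 1 ≤ n, f^[n] '' critSet f

/-- The set of `n`-vertices `f⁻ⁿ(post(f))`. -/
def vertexSet (f : S → S) (n : ℕ) : Set S := f^[n] ⁻¹' postSet f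

/-- The set of `n`-edges: closures of the components of `f⁻ⁿ(C) ∖ f⁻ⁿ(post(f))`. -/
def edgeSet (f : S → S) (C : Set S) (n : ℕ) : Set (Set S) :=
  {E | ∃ x ∈ f^[n] ⁻¹' C \ vertexSet f n,
    E = closure (connectedComponentIn (f^[n] ⁻¹' C \ vertexSet f n) x)}

/-- An oriented `n`-edge: an `n`-edge with its two end points (which are the `n`-vertices that it
contains) labelled as initial and terminal point. -/
structure OrientedEdge (f : S → S) (C : Set S) (n : ℕ) where
  carrier : Set S
  init : S
  term : S
  mem_edgeSet : carrier ∈ edgeSet f C n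
  endpoints : carrier ∩ vertexSet f n = {init, term}
  init_ne_term : init ≠ term

/-! ### Eulerian circuits -/

/-- A cyclic sequence of oriented `n`-edges is an Eulerian circuit if each `n`-edge appears exactly
once and each edge ends where the next one starts. -/
structure IsEulerianCircuit {f : S → S} {C : Set S} {n N : ℕ}
    (γ : ZMod N → OrientedEdge f C n) : Prop where
  existsUnique : ∀ E ∈ edgeSet f C n, ∃! j, (γ j).carrier = E
  succ : ∀ j, (γ j).term = (γ (j + 1)).init

/-- The closed curve `g` runs through the circuit `γ`: the circle `ℝ/ℤ` is divided cyclically into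
arcs `[w j, w (j + 1)]`, and `g` maps the `j`-th arc homeomorphically onto the `j`-th edge of the
circuit, respecting orientations. -/
def Traverses {f : S → S} {C : Set S} {n N : ℕ} (g : AddCircle (1 : ℝ) → S)
    (γ : ZMod N → OrientedEdge f C n) : Prop :=
  Continuous g ∧ ∃ w : ℤ → ℝ, StrictMono w ∧ (∀ j, w (j + N) = w j + 1) ∧
    ∀ j : ℤ,
      Set.InjOn (fun t : ℝ => g (t : AddCircle (1 : ℝ))) (Set.Icc (w j) (w (j + 1))) ∧
      (fun t : ℝ => g (t : AddCircle (1 : ℝ))) '' Set.Icc (w j) (w (j + 1)) =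
        (γ (j : ZMod N)).carrier ∧
      g (w j : AddCircle (1 : ℝ)) = (γ (j : ZMod N)).init ∧
      g (w (j + 1) : AddCircle (1 : ℝ)) = (γ (j : ZMod N)).term

/-- `f` maps the oriented `(n+1)`-edge `E'` to the oriented `n`-edge `E`. -/
def MapsEdge {f : S → S} {C : Set S} {n : ℕ}
    (E' : OrientedEdge f C (n + 1)) (E : OrientedEdge f C n) : Prop :=
  f '' E'.carrier = E.carrier ∧ f E'.init = E.init ∧ f E'.term = E.term

/-- `f : γ' → γ` is a `d`-fold cover: `f(E'_j) = E_{m+j}` for all `j`, indices being cyclic. -/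
def IsFoldCover {f : S → S} {C : Set S} {n N : ℕ} (d : ℕ)
    (γ' : ZMod (d * N) → OrientedEdge f C (n + 1)) (γ : ZMod N → OrientedEdge f C n) : Prop :=
  ∃ m : ZMod N, ∀ j : ℕ, MapsEdge (γ' (j : ZMod (d * N))) (γ (m + (j : ZMod N)))

/-! ### Pseudo-isotopies -/

/-- `H` is a pseudo-isotopy rel. `A`: a homotopy starting at the identity, all of whose stages
before time `1` are homeomorphisms, and which does not move the points of `A`. -/
structure IsPseudoIsotopyRel (H : S → unitInterval → S) (A : Set S) : Prop where
  continuous : Continuous (Function.uncurry H)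
  zero : ∀ x, H x 0 = x
  isHomeomorph : ∀ t : unitInterval, t < 1 → IsHomeomorph fun x => H x t
  rel : ∀ a ∈ A, ∀ t, H a t = a

/-- The initial pseudo-isotopies `H⁰` for the map `f` of degree `d` and the oriented Jordan curve
`C ⊇ post(f)` with parametrization `g`. -/
structure IsInitialPseudoIsotopy (f : S → S) (d : ℕ) (g : AddCircle (1 : ℝ) → S)
    (H : S → unitInterval → S) : Prop where
  /-- `H` is a pseudo-isotopy rel. `post(f)`. -/
  pseudoIsotopy : IsPseudoIsotopyRel H (postSet f)
  /-- `H` deforms the union of all `0`-edges to the union of all `1`-edges. -/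
  image_curve : (fun x => H x 1) '' ⋃₀ edgeSet f (Set.range g) 0 =
    ⋃₀ edgeSet f (Set.range g) 1
  /-- Near time `1`, `H` is supported on a small neighborhood of the set of `1`-vertices. -/
  freezes : ∀ V : Set S, IsOpen V → vertexSet f 1 ⊆ V →
    ∃ ε : ℝ, 0 < ε ∧ ∀ t : unitInterval, 1 - ε ≤ (t : ℝ) → ∀ x ∉ V, H x t = H x 1
  /-- Only finitely many points of the curve are deformed to a given `1`-vertex. -/
  finite_fiber : ∀ v ∈ vertexSet f 1, {x ∈ Set.range g | H x 1 = v}.Finite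
  /-- The circuit obtained from `H` is an Eulerian circuit that is a `d`-fold cover of the circuit
  of `0`-edges. -/
  cover : ∃ (N : ℕ) (γ₀ : ZMod N → OrientedEdge f (Set.range g) 0)
    (γ₁ : ZMod (d * N) → OrientedEdge f (Set.range g) 1),
    NeZero N ∧ IsEulerianCircuit γ₀ ∧ Traverses g γ₀ ∧
    IsEulerianCircuit γ₁ ∧ Traverses (fun s => H (g s) 1) γ₁ ∧ IsFoldCover d γ₁ γ₀

end General

/-!
The proof lifts everything to the plane. The half lattice `½ L = (√2 / 2) ℤ + i ℤ` is, up to scaling,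
the ring `ℤ[√-2]`, and `ψ` is multiplication by `√-2`. The critical points of `h` are the points
`℘ z` with `2 ψ z ∈ L` and `2 z ∉ L` (`critSet_lattesMap`: in the quotient coordinate around a cone
point `h` is `s ↦ s ^ 2` there, and `h` is injective near every other point), so that `post(h)`
consists of the four cone points `℘ (½ L)` (`postSet_lattesMap`).

Let `H` be an initial pseudo-isotopy. The curve `C` has four edges, and `H₁` fixes the four
postcritical points, so these occur on `C` and in the circuit of eight `1`-edges in the same cyclic
order. Since that circuit covers the curve twice, `cyclic_order` leaves only the two orders in which
`℘ 0` and `℘ i` are opposite, and shows that the image under `H₁` of each `0`-edge consists of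
exactly two consecutive `1`-edges.

Let `u₀, u₁, u₂, u₃ ∈ ½ L` be the displacements of lifts of the four edges of `C`, starting at
`℘ 0`; each is defined up to sign, as `℘` is a covering away from the cone points
(`isCoveringMapOn_pillowProj`, `displacement_eq_or_eq_neg`). On the interior of an edge the homotopy
`H` avoids the cone points up to and including time `1`, hence it lifts, and the lift does not move
the end points (`exists_lift_homotopy`). So the image of the edge under `H₁` has a lift with
displacement `uⱼ` as well. Now `ψ` maps this lift to a lift of two consecutive edges of `C`, and
therefore
`ψ u₀ = ± u₀ ± u₁`, `ψ u₁ = ± u₂ ± u₃`, `ψ u₂ = ± u₀ ± u₁`, `ψ u₃ = ± u₂ ± u₃`.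
For no choice of the signs do these equations have a solution in `½ L` with the residues modulo `L`
that the order of the postcritical points prescribes (`not_isSignedSum_halfPoint`).
-/

open Topology

/-! ### The quotient map to the pillow -/

theorem continuous_pillowProj : Continuous pillowProj := continuous_quotient_mk'

theorem surjective_pillowProj : Function.Surjective pillowProj := Quotient.exists_rep

instance : T2Space Pillow :=
  pillow_homeomorph_sphere.some.symm.t2Space

theorem isOpenMap_pillowProj : IsOpenMap pillowProj := by
  intro U hU
  have hq : IsQuotientMap pillowProj := isQuotientMap_quotient_mk'
  rw [← hq.isOpen_preimage]
  have : pillowProj ⁻¹' (pillowProj '' U) =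
      ⋃ l ∈ lattesLattice, ((fun z => z - l) ⁻¹' U ∪ (fun z => l - z) ⁻¹' U) := by
    ext z
    simp only [Set.mem_preimage, Set.mem_image, Set.mem_iUnion, Set.mem_union, exists_prop]
    constructor
    · rintro ⟨w, hw, h⟩
      rcases (pillowProj_eq_iff _ _).1 h with h | h
      · exact ⟨z - w, h, Or.inl (by simpa using hw)⟩
      · exact ⟨z + w, h, Or.inr (by simpa using hw)⟩
    · rintro ⟨l, hl, h | h⟩
      · exact ⟨_, h, (pillowProj_eq_iff _ _).2 (Or.inl (by simpa using hl))⟩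
      · exact ⟨_, h, (pillowProj_eq_iff _ _).2 (Or.inr (by simpa using hl))⟩
  rw [this]
  exact isOpen_biUnion fun l _ =>
    (hU.preimage (by fun_prop)).union (hU.preimage (by fun_prop))

theorem pillowProj_eq_zero_iff (z : ℂ) : pillowProj z = pillowProj 0 ↔ z ∈ lattesLattice := by
  rw [pillowProj_eq_iff]
  simp

theorem isClosed_lattesLattice : IsClosed (lattesLattice : Set ℂ) := by
  have : (lattesLattice : Set ℂ) = pillowProj ⁻¹' {pillowProj 0} := by
    ext z
    simp [pillowProj_eq_zero_iff]
  rw [this]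
  exact isClosed_singleton.preimage continuous_pillowProj

/-- Nonzero lattice vectors have norm at least `1`. -/
theorem eq_zero_of_mem_lattesLattice {l : ℂ} (hl : l ∈ lattesLattice) (h : ‖l‖ < 1) : l = 0 := by
  obtain ⟨m, n, rfl⟩ := hl
  have h2 : (1 : ℝ) ≤ Real.sqrt 2 := Real.one_le_sqrt.2 (by norm_num)
  have key : ∀ (k : ℤ) (c : ℝ), 1 ≤ c → |(k : ℝ) * c| < 1 → k = 0 := by
    intro k c hc hk
    rw [← Int.abs_lt_one_iff]
    rw [abs_mul, abs_of_nonneg (by linarith : (0 : ℝ) ≤ c)] at hk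
    have : ((|k| : ℤ) : ℝ) < 1 := by
      push_cast
      nlinarith [abs_nonneg (k : ℝ)]
    exact_mod_cast this
  have hre := (Complex.abs_re_le_norm _).trans_lt h
  have him := (Complex.abs_im_le_norm _).trans_lt h
  have hm := key m _ h2 (by simpa using hre)
  have hn := key n 2 (by norm_num) (by simpa using him)
  simp [hm, hn]

/-! ### The lift of the Lattès map -/

theorem lattesLift_add (z w : ℂ) : lattesLift (z + w) = lattesLift z + lattesLift w := by
  unfold lattesLift; ring

theorem lattesLift_sub (z w : ℂ) : lattesLift (z - w) = lattesLift z - lattesLift w := by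
  unfold lattesLift; ring

theorem lattesLift_two_mul (z : ℂ) : lattesLift (2 * z) = 2 * lattesLift z := by
  unfold lattesLift; ring

theorem norm_lattesLift (z : ℂ) : ‖lattesLift z‖ = Real.sqrt 2 * ‖z‖ := by
  simp [lattesLift, abs_of_nonneg (Real.sqrt_nonneg 2)]

theorem continuous_lattesLift : Continuous lattesLift := by
  unfold lattesLift; fun_prop

theorem lattesLift_lattesLift (z : ℂ) : lattesLift (lattesLift z) = -2 * z := by
  have h2 : (Real.sqrt 2 : ℂ) * (Real.sqrt 2 : ℂ) = 2 := by
    rw [← Complex.ofReal_mul, Real.mul_self_sqrt (by norm_num)]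
    norm_num
  unfold lattesLift
  linear_combination Complex.I * Complex.I * z * h2 + 2 * z * Complex.I_mul_I

theorem eq_zero_of_lattesLift_mem {z : ℂ} (hz : lattesLift z ∈ lattesLattice) (h : ‖z‖ < 2⁻¹) :
    z = 0 := by
  have hs : Real.sqrt 2 ≤ 2 := by
    rw [Real.sqrt_le_left (by norm_num)]
    norm_num
  have := eq_zero_of_mem_lattesLattice hz (by
    rw [norm_lattesLift]
    nlinarith [norm_nonneg z])
  have h0 := norm_lattesLift z
  rw [this, norm_zero] at h0
  have : Real.sqrt 2 ≠ 0 := by positivity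
  simpa [this] using h0.symm

/-! ### Critical points -/

/-- A map with a local degree at least two is not injective near the point. -/
theorem not_mem_critSet_of_injOn {S : Type*} [TopologicalSpace S] {f : S → S} {v : S} {U : Set S}
    (hU : U ∈ 𝓝 v) (hf : Set.InjOn f U) : v ∉ critSet f := by
  rintro ⟨q, hq, φ, χ, hv, hv0, ht, -, -, -, hmaps, hpow⟩
  have h0 : (0 : ℂ) ∈ φ.target := by rw [ht]; simp
  have hsymm : φ.symm 0 = v := by rw [← hv0, φ.left_inv hv]
  have hW : φ.target ∩ φ.symm ⁻¹' U ∈ 𝓝 (0 : ℂ) :=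
    Filter.inter_mem (φ.open_target.mem_nhds h0)
      ((φ.continuousAt_symm h0).preimage_mem_nhds (by rwa [hsymm]))
  obtain ⟨r, hr, hball⟩ := Metric.mem_nhds_iff.1 hW
  obtain ⟨ζ, hζ⟩ : ∃ ζ : ℂ, IsPrimitiveRoot ζ q :=
    ⟨_, Complex.isPrimitiveRoot_exp q (by omega)⟩
  have hζ1 : ‖ζ‖ = 1 := hζ.norm'_eq_one (by omega)
  have hz : ((r / 2 : ℝ) : ℂ) ∈ Metric.ball (0 : ℂ) r := by
    rw [mem_ball_zero_iff, Complex.norm_real, Real.norm_of_nonneg (by linarith)]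
    linarith
  have hz' : ζ * ((r / 2 : ℝ) : ℂ) ∈ Metric.ball (0 : ℂ) r := by
    rw [mem_ball_zero_iff, norm_mul, hζ1, one_mul]
    exact mem_ball_zero_iff.1 hz
  obtain ⟨a1, a2⟩ := hball hz
  obtain ⟨b1, b2⟩ := hball hz'
  have hs1 := φ.map_target a1
  have hs2 := φ.map_target b1
  have e : f (φ.symm ((r / 2 : ℝ) : ℂ)) = f (φ.symm (ζ * ((r / 2 : ℝ) : ℂ))) := by
    apply χ.injOn (hmaps hs1) (hmaps hs2)
    rw [hpow _ hs1, hpow _ hs2, φ.right_inv a1, φ.right_inv b1, mul_pow, hζ.pow_eq_one, one_mul]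
  have e2 := φ.symm.injOn a1 b1 (hf a2 b2 e)
  have hne : ((r / 2 : ℝ) : ℂ) ≠ 0 := by
    rw [Complex.ofReal_ne_zero]
    linarith
  have : ζ = 1 := by
    have : (ζ - 1) * ((r / 2 : ℝ) : ℂ) = 0 := by rw [sub_mul, one_mul, ← e2, sub_self]
    rcases mul_eq_zero.1 this with h | h
    · exact sub_eq_zero.1 h
    · exact absurd h hne
  exact hζ.ne_one (by omega) this

theorem not_mem_critSet_lattesMap {z : ℂ}
    (hz : lattesLift (2 * z) ∈ lattesLattice → 2 * z ∈ lattesLattice) :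
    pillowProj z ∉ critSet lattesMap := by
  -- a radius for which two points of the ball with the same image are related by `±` mod `L`
  obtain ⟨r, hr, hr', hrz⟩ : ∃ r : ℝ, 0 < r ∧ r ≤ 4⁻¹ ∧ ∀ δ : ℂ, ‖δ‖ < 2 * r →
      lattesLift (2 * z + δ) ∈ lattesLattice → 2 * z + δ ∈ lattesLattice := by
    by_cases h : lattesLift (2 * z) ∈ lattesLattice
    · refine ⟨4⁻¹, by norm_num, le_rfl, fun δ hδ hL => ?_⟩
      rw [lattesLift_add] at hL
      have h1 : lattesLift δ ∈ lattesLattice := by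
        simpa using lattesLattice.sub_mem hL h
      rw [eq_zero_of_lattesLift_mem h1 (by norm_num at hδ ⊢; linarith), add_zero]
      exact hz h
    · have hopen : IsOpen (lattesLift ⁻¹' (lattesLattice : Set ℂ))ᶜ :=
        (isClosed_lattesLattice.preimage continuous_lattesLift).isOpen_compl
      obtain ⟨ε, hε, hball⟩ := Metric.isOpen_iff.1 hopen (2 * z) h
      refine ⟨min (ε / 2) 4⁻¹, by positivity, min_le_right _ _, fun δ hδ hL => ?_⟩
      refine absurd hL (hball ?_)
      rw [Metric.mem_ball, dist_eq_norm, add_sub_cancel_left]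
      linarith [min_le_left (ε / 2) (4⁻¹ : ℝ)]
  refine not_mem_critSet_of_injOn (U := pillowProj '' Metric.ball z r)
    ((isOpenMap_pillowProj _ Metric.isOpen_ball).mem_nhds ⟨z, Metric.mem_ball_self hr, rfl⟩) ?_
  rintro _ ⟨x, hx, rfl⟩ _ ⟨y, hy, rfl⟩ hxy
  rw [Metric.mem_ball, dist_eq_norm] at hx hy
  rw [lattesMap_pillowProj, lattesMap_pillowProj, pillowProj_eq_iff, ← lattesLift_sub,
    ← lattesLift_add] at hxy
  rw [pillowProj_eq_iff]
  rcases hxy with h | h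
  · have : y - x = 0 := eq_zero_of_lattesLift_mem h (by
      calc ‖y - x‖ = ‖(y - z) - (x - z)‖ := by congr 1; ring
        _ ≤ ‖y - z‖ + ‖x - z‖ := norm_sub_le _ _
        _ < 2⁻¹ := by norm_num at hr' ⊢; linarith)
    rw [this]
    exact Or.inl lattesLattice.zero_mem
  · right
    have e : y + x = 2 * z + ((y - z) + (x - z)) := by ring
    rw [e] at h ⊢
    refine hrz _ ?_ h
    have := norm_add_le (y - z) (x - z)
    linarith

/-- A continuous open map that is injective on the unit disk parametrizes a chart. -/
theorem exists_chart {X : Type*} [TopologicalSpace X] {f : ℂ → X} (hc : Continuous f)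
    (ho : IsOpenMap f) (hf : Set.InjOn f (Metric.ball 0 1)) :
    ∃ φ : OpenPartialHomeomorph X ℂ, φ.source = f '' Metric.ball 0 1 ∧
      φ.target = Metric.ball 0 1 ∧ ∀ z ∈ Metric.ball (0 : ℂ) 1, φ (f z) = z := by
  let e := OpenPartialHomeomorph.ofContinuousOpen (hf.toPartialEquiv f _) hc.continuousOn ho
    Metric.isOpen_ball
  exact ⟨e.symm, rfl, rfl, fun z hz => e.left_inv hz⟩

/-- Around a cone point `℘ p`, the quotient of a disk by `±1` is again a disk: the coordinate is
`℘ (p + (√2 / 4) s) ↦ s ^ 2`. -/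
theorem exists_chart_conePoint {p : ℂ} (hp : 2 * p ∈ lattesLattice) :
    ∃ χ : OpenPartialHomeomorph Pillow ℂ, χ.target = Metric.ball 0 1 ∧
      ∀ s ∈ Metric.ball (0 : ℂ) 1, pillowProj (p + (Real.sqrt 2 / 4 : ℝ) * s) ∈ χ.source ∧
        χ (pillowProj (p + (Real.sqrt 2 / 4 : ℝ) * s)) = s ^ 2 := by
  set R : ℝ := Real.sqrt 2 / 4 with hR
  have hRpos : 0 < R := by positivity
  have hR0 : (R : ℂ) ≠ 0 := by exact_mod_cast hRpos.ne'
  have hR1 : R ≤ 2⁻¹ := by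
    have : Real.sqrt 2 ≤ 2 := by
      rw [Real.sqrt_le_left (by norm_num)]
      norm_num
    rw [hR]
    linarith
  -- `σ` is a square root, not necessarily continuous
  choose σ hσ' using fun z : ℂ => IsAlgClosed.exists_pow_nat_eq z (n := 2) two_pos
  have hσ : ∀ z, z = σ z ^ 2 := fun z => (hσ' z).symm
  let F : ℂ → Pillow := fun s => pillowProj (p + R * s)
  let f : ℂ → Pillow := fun z => F (σ z)
  have hF : ∀ s, f (s ^ 2) = F s := by
    intro s
    rcases sq_eq_sq_iff_eq_or_eq_neg.1 (hσ (s ^ 2)) with h | h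
    · change F (σ (s ^ 2)) = F s
      rw [← h]
    · have h' : σ (s ^ 2) = -s := by linear_combination h
      simp only [f, F, h']
      rw [pillowProj_eq_iff]
      right
      convert hp using 1
      ring
  have hsq := Complex.isOpenQuotientMap_pow 2
  have hFc : Continuous F := continuous_pillowProj.comp (by fun_prop)
  have hFo : IsOpenMap F := by
    refine isOpenMap_pillowProj.comp ?_
    exact (isOpenMap_add_left p).comp (isOpenMap_smul₀ hR0)
  have hcomp : f ∘ (fun s : ℂ => s ^ 2) = F := funext hF
  have hfc : Continuous f := by
    rw [hsq.isQuotientMap.continuous_iff, hcomp]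
    exact hFc
  have hfo : IsOpenMap f := by
    intro W hW
    have : f '' W = F '' ((fun s : ℂ => s ^ 2) ⁻¹' W) := by
      rw [← hcomp, Set.image_comp, Set.image_preimage_eq _ hsq.surjective]
    rw [this]
    exact hFo _ (hW.preimage hsq.continuous)
  have hfi : Set.InjOn f (Metric.ball 0 1) := by
    intro z hz w hw hzw
    have hσn : ∀ z ∈ Metric.ball (0 : ℂ) 1, ‖σ z‖ < 1 := by
      intro z hz
      rw [mem_ball_zero_iff, hσ z, norm_pow] at hz
      exact (sq_lt_one_iff₀ (norm_nonneg _)).1 hz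
    have h1 := hσn z hz
    have h2 := hσn w hw
    simp only [f, F] at hzw
    rw [pillowProj_eq_iff] at hzw
    rw [hσ z, hσ w]
    have small : ∀ δ : ℂ, ‖δ‖ < 2 → (R : ℂ) * δ ∈ lattesLattice → δ = 0 := by
      intro δ hδ hL
      have := eq_zero_of_mem_lattesLattice hL (by
        rw [norm_mul, Complex.norm_real, Real.norm_of_nonneg hRpos.le]
        nlinarith [norm_nonneg δ])
      simpa [hR0] using this
    rcases hzw with h | h
    · have := small (σ w - σ z) (by linarith [norm_sub_le (σ w) (σ z)])
        (by convert h using 1; ring)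
      rw [sub_eq_zero.1 this]
    · have := small (σ w + σ z) (by linarith [norm_add_le (σ w) (σ z)])
        (by convert lattesLattice.sub_mem h hp using 1; ring)
      rw [eq_neg_of_add_eq_zero_left this, neg_sq]
  obtain ⟨χ, hs, ht, hχ⟩ := exists_chart hfc hfo hfi
  have hmem : ∀ s ∈ Metric.ball (0 : ℂ) 1, s ^ 2 ∈ Metric.ball (0 : ℂ) 1 := by
    intro s hs
    rw [mem_ball_zero_iff] at hs ⊢
    rw [norm_pow]
    exact pow_lt_one₀ (norm_nonneg _) hs two_ne_zero
  refine ⟨χ, ht, fun s hs' => ⟨?_, ?_⟩⟩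
  · rw [hs]
    exact ⟨s ^ 2, hmem s hs', hF s⟩
  · exact (congrArg χ (hF s)).symm.trans (hχ _ (hmem s hs'))

theorem mem_critSet_lattesMap {z : ℂ} (h1 : lattesLift (2 * z) ∈ lattesLattice)
    (h2 : 2 * z ∉ lattesLattice) : pillowProj z ∈ critSet lattesMap := by
  have hp : 2 * lattesLift z ∈ lattesLattice := lattesLift_two_mul z ▸ h1
  obtain ⟨χ, hχt, hχ⟩ := exists_chart_conePoint hp
  -- the scaling factor `ρ` is chosen so that `ψ (ρ s) = (√2 / 4) s`
  set ρ : ℂ := -Complex.I / 4 with hρ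
  have hρ0 : ρ ≠ 0 := by simp [hρ]
  have hρn : ‖ρ‖ = 4⁻¹ := by simp [hρ]
  have hψρ : ∀ s, lattesLift (z + ρ * s) = lattesLift z + (Real.sqrt 2 / 4 : ℝ) * s := by
    intro s
    unfold lattesLift
    rw [hρ]
    push_cast
    linear_combination -(Real.sqrt 2 : ℂ) / 4 * s * Complex.I_mul_I
  obtain ⟨φ, hφs, hφt, hφ⟩ := exists_chart (f := fun s => pillowProj (z + ρ * s))
    (continuous_pillowProj.comp (by fun_prop))
    (isOpenMap_pillowProj.comp ((isOpenMap_add_left z).comp (isOpenMap_smul₀ hρ0))) (by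
      intro s hs t ht hst
      rw [mem_ball_zero_iff] at hs ht
      simp only at hst
      rw [pillowProj_eq_iff] at hst
      rcases hst with h | h
      · have h3 := eq_zero_of_mem_lattesLattice (l := ρ * (t - s))
          (by convert h using 1; ring) (by
            rw [norm_mul, hρn]
            linarith [norm_sub_le t s])
        have : t - s = 0 := by simpa [hρ0] using h3
        exact (sub_eq_zero.1 this).symm
      · exfalso
        have h3 : lattesLift (ρ * (t + s)) ∈ lattesLattice := by
          have := lattesLattice.sub_mem (lattesLift_mem h) h1
          rw [← lattesLift_sub] at this
          convert this using 2
          ring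
        have h4 := eq_zero_of_lattesLift_mem h3 (by
          rw [norm_mul, hρn]
          norm_num
          linarith [norm_add_le t s])
        apply h2
        convert h using 1
        linear_combination -h4)
  have h0 : (0 : ℂ) ∈ Metric.ball (0 : ℂ) 1 := Metric.mem_ball_self one_pos
  have hφ0 := hφ 0 h0
  have hχ0 := hχ 0 h0
  simp only [mul_zero, add_zero] at hφ0 hχ0
  refine ⟨2, le_rfl, φ, χ, ?_, hφ0, hφt, ?_, ?_, hχt, ?_, ?_⟩
  · rw [hφs]
    exact ⟨0, h0, by simp⟩
  · exact hχ0.1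
  · rw [lattesMap_pillowProj, hχ0.2]
    simp
  · rw [hφs]
    rintro _ ⟨s, hs, rfl⟩
    simp only [lattesMap_pillowProj, hψρ]
    exact (hχ s hs).1
  · rw [hφs]
    rintro _ ⟨s, hs, rfl⟩
    rw [hφ s hs, lattesMap_pillowProj, hψρ]
    exact (hχ s hs).2

/-! ### The half lattice and the postcritical set -/

/-- The point `x (√2 / 2) + y i` of the half lattice `½ L = (√2 / 2) ℤ + i ℤ`. -/
noncomputable def halfPoint (x y : ℤ) : ℂ :=
  (x : ℂ) * ((Real.sqrt 2 : ℂ) / 2) + (y : ℂ) * Complex.I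

theorem two_mul_halfPoint_mem (x y : ℤ) : 2 * halfPoint x y ∈ lattesLattice :=
  ⟨x, y, by unfold halfPoint; ring⟩

theorem exists_halfPoint {z : ℂ} (hz : 2 * z ∈ lattesLattice) : ∃ x y, z = halfPoint x y := by
  obtain ⟨m, n, h⟩ := hz
  exact ⟨m, n, by unfold halfPoint; linear_combination h / 2⟩

theorem lattesLift_halfPoint (x y : ℤ) : lattesLift (halfPoint x y) = halfPoint (-2 * y) x := by
  have h2 : (Real.sqrt 2 : ℂ) * (Real.sqrt 2 : ℂ) = 2 := by
    rw [← Complex.ofReal_mul, Real.mul_self_sqrt (by norm_num)]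
    norm_num
  unfold lattesLift halfPoint
  push_cast
  linear_combination (x : ℂ) * Complex.I * h2 / 2 + (y : ℂ) * (Real.sqrt 2 : ℂ) * Complex.I_mul_I

theorem halfPoint_add (x y x' y' : ℤ) :
    halfPoint x y + halfPoint x' y' = halfPoint (x + x') (y + y') := by
  unfold halfPoint; push_cast; ring

theorem halfPoint_sub (x y x' y' : ℤ) :
    halfPoint x y - halfPoint x' y' = halfPoint (x - x') (y - y') := by
  unfold halfPoint; push_cast; ring

theorem halfPoint_neg (x y : ℤ) : -halfPoint x y = halfPoint (-x) (-y) := by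
  unfold halfPoint; push_cast; ring

theorem halfPoint_inj {x y x' y' : ℤ} :
    halfPoint x y = halfPoint x' y' ↔ x = x' ∧ y = y' := by
  constructor
  · intro h
    have hre := congrArg Complex.re h
    have him := congrArg Complex.im h
    simp [halfPoint] at hre him
    exact ⟨hre, him⟩
  · rintro ⟨rfl, rfl⟩
    rfl

theorem halfPoint_mem_lattesLattice {x y : ℤ} :
    halfPoint x y ∈ lattesLattice ↔ Even x ∧ Even y := by
  have key : ∀ m n : ℤ, (m : ℂ) * (Real.sqrt 2 : ℂ) + (n : ℂ) * (2 * Complex.I) =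
      halfPoint (m + m) (n + n) := by
    intro m n
    unfold halfPoint
    push_cast
    ring
  constructor
  · rintro ⟨m, n, h⟩
    rw [key, halfPoint_inj] at h
    exact ⟨⟨m, h.1⟩, ⟨n, h.2⟩⟩
  · rintro ⟨⟨m, rfl⟩, ⟨n, rfl⟩⟩
    exact ⟨m, n, (key m n).symm⟩

/-- The image in the pillow of a point of the half lattice. -/
noncomputable def conePoint (x y : ℤ) : Pillow := pillowProj (halfPoint x y)

theorem conePoint_eq_iff {x y x' y' : ℤ} :
    conePoint x y = conePoint x' y' ↔ Even (x' - x) ∧ Even (y' - y) := by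
  rw [conePoint, conePoint, pillowProj_eq_iff, halfPoint_sub, halfPoint_add,
    halfPoint_mem_lattesLattice, halfPoint_mem_lattesLattice]
  simp only [Int.even_add, Int.even_sub, or_self]

theorem lattesMap_conePoint (x y : ℤ) : lattesMap (conePoint x y) = conePoint 0 x := by
  rw [conePoint, lattesMap_pillowProj, lattesLift_halfPoint]
  change conePoint _ _ = _
  rw [conePoint_eq_iff]
  exact ⟨⟨y, by ring⟩, by simp⟩

/-- The points of the plane over the cone points form the half lattice. -/
theorem pillowProj_eq_conePoint {z : ℂ} {x y : ℤ} (h : pillowProj z = conePoint x y) :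
    2 * z ∈ lattesLattice := by
  have h2 := two_mul_halfPoint_mem x y
  rcases (pillowProj_eq_iff _ _).1 h with h | h
  · convert lattesLattice.sub_mem h2 (lattesLattice.add_mem h h) using 1
    ring
  · convert lattesLattice.sub_mem (lattesLattice.add_mem h h) h2 using 1
    ring

theorem critSet_lattesMap : critSet lattesMap =
    {p | ∃ z, p = pillowProj z ∧ lattesLift (2 * z) ∈ lattesLattice ∧ 2 * z ∉ lattesLattice} := by
  ext p
  obtain ⟨z, rfl⟩ := surjective_pillowProj p
  constructor
  · intro h
    by_contra hcon
    refine not_mem_critSet_lattesMap (z := z) (fun h1 => ?_) h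
    by_contra h2
    exact hcon ⟨z, rfl, h1, h2⟩
  · rintro ⟨w, hw, h1, h2⟩
    rw [hw]
    exact mem_critSet_lattesMap h1 h2

/-- The postcritical points of the Lattès map are the four cone points of the pillow. -/
theorem postSet_lattesMap : postSet lattesMap = {p | ∃ x y, p = conePoint x y} := by
  ext p
  simp only [postSet, Set.mem_iUnion, Set.mem_image, Set.mem_ofPred_eq, exists_prop]
  constructor
  · rintro ⟨n, hn, v, hv, rfl⟩
    rw [critSet_lattesMap] at hv
    obtain ⟨z, rfl, h1, -⟩ := hv
    rw [lattesLift_two_mul] at h1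
    obtain ⟨x, y, hxy⟩ := exists_halfPoint h1
    obtain ⟨n, rfl⟩ : ∃ k, n = k + 1 := ⟨n - 1, by omega⟩
    rw [Function.iterate_succ_apply, lattesMap_pillowProj, hxy]
    clear hn
    have : ∀ k x y, ∃ x' y', lattesMap^[k] (conePoint x y) = conePoint x' y' := by
      intro k
      induction k with
      | zero => exact fun x y => ⟨x, y, rfl⟩
      | succ k ih =>
        intro x y
        rw [Function.iterate_succ_apply, lattesMap_conePoint]
        exact ih _ _
    exact this n x y
  · rintro ⟨x, y, rfl⟩
    -- the two critical values are the cone points with odd first coordinate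
    have hval : ∀ x y : ℤ, Odd x → ∃ v ∈ critSet lattesMap, lattesMap v = conePoint x y := by
      intro x y hx
      have e : lattesLift (-(lattesLift (halfPoint x y)) / 2) = halfPoint x y := by
        have := lattesLift_lattesLift (halfPoint x y)
        unfold lattesLift at this ⊢
        linear_combination -this / 2
      refine ⟨pillowProj (-(lattesLift (halfPoint x y)) / 2), ?_, ?_⟩
      · rw [critSet_lattesMap]
        refine ⟨_, rfl, ?_, ?_⟩
        · rw [lattesLift_two_mul, e]
          exact two_mul_halfPoint_mem x y
        · have : 2 * (-(lattesLift (halfPoint x y)) / 2) = halfPoint (2 * y) (-x) := by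
            rw [lattesLift_halfPoint, ← neg_neg (2 * y), ← halfPoint_neg]
            simp only [neg_mul]
            ring
          rw [this, halfPoint_mem_lattesLattice, not_and, even_neg, Int.not_even_iff_odd]
          exact fun _ => hx
      · rw [lattesMap_pillowProj, e]
        rfl
    rcases Int.even_or_odd x with hx | hx
    · rcases Int.even_or_odd y with hy | hy
      · obtain ⟨v, hv, h⟩ := hval 1 0 odd_one
        refine ⟨3, by norm_num, v, hv, ?_⟩
        simp only [Function.iterate_succ_apply, Function.iterate_zero, id, h, lattesMap_conePoint]
        rw [conePoint_eq_iff]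
        simp [hx, hy]
      · obtain ⟨v, hv, h⟩ := hval 1 0 odd_one
        refine ⟨2, by norm_num, v, hv, ?_⟩
        simp only [Function.iterate_succ_apply, Function.iterate_zero, id, h, lattesMap_conePoint]
        rw [conePoint_eq_iff]
        simp [hx, hy]
    · obtain ⟨v, hv, h⟩ := hval x y hx
      exact ⟨1, le_rfl, v, hv, h⟩

theorem pillowProj_mem_postSet {z : ℂ} :
    pillowProj z ∈ postSet lattesMap ↔ 2 * z ∈ lattesLattice := by
  rw [postSet_lattesMap]
  constructor
  · rintro ⟨x, y, h⟩
    exact pillowProj_eq_conePoint h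
  · intro h
    obtain ⟨x, y, rfl⟩ := exists_halfPoint h
    exact ⟨x, y, rfl⟩

/-! ### Lifting paths and homotopies to the plane -/

/-- The group of the maps `z ↦ ± z + l` with `l ∈ L`, whose orbits are the fibers of `℘`. -/
def pillowGroup : Subgroup (Equiv.Perm ℂ) where
  carrier := {f | ∃ l ∈ lattesLattice, (∀ z, f z = z + l) ∨ ∀ z, f z = -z + l}
  one_mem' := ⟨0, lattesLattice.zero_mem, Or.inl (by simp)⟩
  mul_mem' := by
    rintro f g ⟨l, hl, hf⟩ ⟨m, hm, hg⟩
    rcases hf with hf | hf <;> rcases hg with hg | hg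
    · exact ⟨m + l, lattesLattice.add_mem hm hl, Or.inl fun z => by simp [hf, hg]; ring⟩
    · exact ⟨m + l, lattesLattice.add_mem hm hl, Or.inr fun z => by simp [hf, hg]; ring⟩
    · exact ⟨-m + l, lattesLattice.add_mem (lattesLattice.neg_mem hm) hl,
        Or.inr fun z => by simp [hf, hg]; ring⟩
    · exact ⟨-m + l, lattesLattice.add_mem (lattesLattice.neg_mem hm) hl,
        Or.inl fun z => by simp [hf, hg]; ring⟩
  inv_mem' := by
    rintro f ⟨l, hl, hf | hf⟩
    · refine ⟨-l, lattesLattice.neg_mem hl, Or.inl fun z => ?_⟩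
      rw [Equiv.Perm.inv_eq_iff_eq, hf]
      ring
    · refine ⟨l, hl, Or.inr fun z => ?_⟩
      rw [Equiv.Perm.inv_eq_iff_eq, hf]
      ring

theorem pillowProj_eq_iff_mem_orbit {z w : ℂ} :
    pillowProj z = pillowProj w ↔ z ∈ MulAction.orbit pillowGroup w := by
  constructor
  · intro h
    rcases (pillowProj_eq_iff _ _).1 h.symm with h | h
    · exact ⟨⟨Equiv.addRight (z - w), _, h, Or.inl fun _ => rfl⟩, add_sub_cancel w z⟩
    · refine ⟨⟨Equiv.subLeft (z + w), _, h, Or.inr fun x => ?_⟩, add_sub_cancel_right z w⟩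
      simp only [Equiv.subLeft_apply]
      ring
  · rintro ⟨⟨f, l, hl, hf | hf⟩, rfl⟩
    · refine (pillowProj_eq_iff _ _).2 (Or.inl ?_)
      change w - f w ∈ _
      rw [hf]
      simpa using lattesLattice.neg_mem hl
    · refine (pillowProj_eq_iff _ _).2 (Or.inr ?_)
      change w + f w ∈ _
      rw [hf]
      simpa using hl

instance : ContinuousConstSMul pillowGroup ℂ where
  continuous_const_smul := by
    rintro ⟨f, l, -, hf | hf⟩
    · change Continuous f
      rw [funext hf]
      fun_prop
    · change Continuous f
      rw [funext hf]
      fun_prop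

/-- Away from the cone points `℘` is a covering. -/
theorem isCoveringMapOn_pillowProj : IsCoveringMapOn pillowProj (postSet lattesMap)ᶜ := by
  have hq : IsQuotientMap pillowProj := isQuotientMap_quotient_mk'
  refine (hq.isCoveringMapOn_of_smul_disjoint pillowProj_eq_iff_mem_orbit (fun e => ?_)).mono ?_
  · -- the ball of radius `2 r` around `2 e` contains no lattice point except possibly `2 e`
    obtain ⟨r, hr, hr', hre⟩ : ∃ r : ℝ, 0 < r ∧ r ≤ 4⁻¹ ∧ ∀ δ : ℂ, ‖δ‖ < 2 * r →
        2 * e + δ ∈ lattesLattice → δ = 0 := by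
      by_cases h : 2 * e ∈ lattesLattice
      · refine ⟨4⁻¹, by norm_num, le_rfl, fun δ hδ hL => ?_⟩
        refine eq_zero_of_mem_lattesLattice ?_ (hδ.trans (by norm_num))
        simpa using lattesLattice.sub_mem hL h
      · obtain ⟨ε, hε, hball⟩ :=
          Metric.isOpen_iff.1 isClosed_lattesLattice.isOpen_compl (2 * e) h
        refine ⟨min (ε / 2) 4⁻¹, by positivity, min_le_right _ _, fun δ hδ hL => ?_⟩
        refine absurd hL (hball ?_)
        rw [Metric.mem_ball, dist_eq_norm, add_sub_cancel_left]
        linarith [min_le_left (ε / 2) (4⁻¹ : ℝ)]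
    refine ⟨Metric.ball e r, Metric.ball_mem_nhds e hr, ?_⟩
    rintro ⟨f, l, hl, hf⟩ ⟨_, ⟨u, hu, rfl⟩, hv⟩
    rw [Metric.mem_ball, dist_eq_norm] at hu hv
    change ‖f u - e‖ < r at hv
    change f e = e
    rcases hf with hf | hf
    · have : l = 0 := by
        refine eq_zero_of_mem_lattesLattice hl ?_
        calc ‖l‖ = ‖(f u - e) - (u - e)‖ := by rw [hf]; congr 1; ring
          _ ≤ ‖f u - e‖ + ‖u - e‖ := norm_sub_le _ _
          _ < 1 := by norm_num at hr'; linarith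
      rw [hf, this, add_zero]
    · have := hre ((f u - e) + (u - e)) (by linarith [norm_add_le (f u - e) (u - e)])
        (by rw [hf]; convert hl using 1; ring)
      rw [hf] at this ⊢
      linear_combination this
  · intro p hp
    obtain ⟨e, rfl⟩ := surjective_pillowProj p
    refine ⟨e, ?_, rfl⟩
    rw [Set.mem_compl_iff, pillowProj_mem_postSet] at hp
    rw [Set.mem_ofPred_eq, Subgroup.eq_bot_iff_forall]
    rintro ⟨f, l, hl, hf⟩ hfe
    replace hfe : f e = e := hfe
    rcases hf with hf | hf
    · have hl0 : l = 0 := by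
        rw [hf] at hfe
        simpa using hfe
      ext z
      change f z = z
      rw [hf, hl0, add_zero]
    · refine absurd ?_ hp
      rw [hf] at hfe
      convert hl using 1
      linear_combination -hfe

/-- A homotopy on an open strip that avoids the cone points lifts to the plane. -/
theorem exists_lift_strip {a b : ℝ} (hab : a < b) {Φ : ℝ × ℝ → Pillow} (hΦ : Continuous Φ)
    (hreg : ∀ s ∈ Set.Ioo a b, ∀ t, Φ (s, t) ∉ postSet lattesMap) :
    ∃ F : ℝ × ℝ → ℂ, ContinuousOn F (Set.Ioo a b ×ˢ Set.univ) ∧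
      ∀ s ∈ Set.Ioo a b, ∀ t, pillowProj (F (s, t)) = Φ (s, t) := by
  set A : Set (ℝ × ℝ) := Set.Ioo a b ×ˢ Set.univ with hA
  have hAo : IsOpen A := isOpen_Ioo.prod isOpen_univ
  have hAc : Convex ℝ A := (convex_Ioo a b).prod convex_univ
  have hAn : A.Nonempty := (Set.nonempty_Ioo.2 hab).prod Set.univ_nonempty
  have : ContractibleSpace A := hAc.contractibleSpace hAn
  have : LocallyPathConnectedSpace A := hAo.locallyPathConnectedSpace
  obtain ⟨x₀, hx₀⟩ := hAn
  obtain ⟨e₀, he₀⟩ := surjective_pillowProj (Φ x₀)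
  obtain ⟨F, ⟨-, hF⟩, -⟩ := isCoveringMapOn_pillowProj.existsUnique_continuousMap_lifts
    (⟨fun x : A => Φ x, by fun_prop⟩ : C(A, Pillow)) (a₀ := ⟨x₀, hx₀⟩) he₀
    (fun x => hreg _ x.2.1 _)
  classical
  refine ⟨fun x => if hx : x ∈ A then F ⟨x, hx⟩ else 0, ?_, fun s hs t => ?_⟩
  · rw [continuousOn_iff_continuous_domRestrict]
    convert F.continuous using 1
    ext x
    simp
  · have hx : (s, t) ∈ A := ⟨hs, trivial⟩
    simp only [dif_pos hx]
    exact congrFun hF ⟨_, hx⟩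

/-- Two points of the plane over the same cone point that are closer than `1/2` agree. -/
theorem eq_of_pillowProj_eq_of_norm_lt {q q' : ℂ} (hq : pillowProj q ∈ postSet lattesMap)
    (hq' : pillowProj q' ∈ postSet lattesMap) (h : ‖q - q'‖ < 2⁻¹) : q = q' := by
  rw [pillowProj_mem_postSet] at hq hq'
  have := eq_zero_of_mem_lattesLattice (l := 2 * (q - q'))
    (by rw [mul_sub]; exact lattesLattice.sub_mem hq hq') (by
      rw [norm_mul, Complex.norm_ofNat]
      linarith)
  rw [mul_eq_zero] at this
  exact sub_eq_zero.1 (this.resolve_left two_ne_zero)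

/-- If a homotopy converges to a fixed cone point at an end of its parameter interval, then each
lift of it converges there to a point of the plane that does not depend on the time. -/
theorem exists_tendsto_lift {S : Set ℝ} (hS : S.OrdConnected) {s₀ : ℝ} [(𝓝[S] s₀).NeBot]
    {Φ : ℝ × ℝ → Pillow} (hΦ : Continuous Φ) {F : ℝ × ℝ → ℂ}
    (hF : ContinuousOn F (S ×ˢ Set.univ))
    (hFΦ : ∀ s ∈ S, ∀ t, pillowProj (F (s, t)) = Φ (s, t)) {P : Pillow}
    (hP : P ∈ postSet lattesMap) (hend : ∀ t ∈ Set.Icc (0 : ℝ) 1, Φ (s₀, t) = P) :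
    ∃ q, pillowProj q = P ∧
      ∀ t ∈ Set.Icc (0 : ℝ) 1, Filter.Tendsto (fun s => F (s, t)) (𝓝[S] s₀) (𝓝 q) := by
  obtain ⟨p, rfl⟩ := surjective_pillowProj P
  -- the preimage of a small disk around the cone point is a disjoint union of disks, and the lift
  -- of a connected piece of the strip stays in one of them
  have main : ∀ r : ℝ, 0 < r → r ≤ 4⁻¹ → ∃ q, pillowProj q = pillowProj p ∧
      ∀ᶠ s in 𝓝[S] s₀, ∀ t ∈ Set.Icc (0 : ℝ) 1, F (s, t) ∈ Metric.ball q r := by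
    intro r hr hr4
    have hev : ∀ᶠ s in 𝓝 s₀, ∀ t ∈ Set.Icc (0 : ℝ) 1,
        Φ (s, t) ∈ pillowProj '' Metric.ball p r := by
      refine isCompact_Icc.eventually_forall_of_forall_eventually fun t ht => ?_
      refine hΦ.continuousAt.preimage_mem_nhds
        ((isOpenMap_pillowProj _ Metric.isOpen_ball).mem_nhds ?_)
      rw [hend t ht]
      exact ⟨p, Metric.mem_ball_self hr, rfl⟩
    obtain ⟨δ, hδ, hball⟩ := Metric.eventually_nhds_iff_ball.1 hev
    have hK : IsPreconnected ((S ∩ Metric.ball s₀ δ) ×ˢ Set.Icc (0 : ℝ) 1) := by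
      refine IsPreconnected.prod ?_ isPreconnected_Icc
      rw [Real.ball_eq_Ioo]
      exact (hS.inter Set.ordConnected_Ioo).isPreconnected
    have hFK := hK.image F (hF.mono (Set.prod_mono Set.inter_subset_left (Set.subset_univ _)))
    have hcov : ∀ x ∈ (S ∩ Metric.ball s₀ δ) ×ˢ Set.Icc (0 : ℝ) 1,
        ∃ q, pillowProj q = pillowProj p ∧ F x ∈ Metric.ball q r := by
      rintro ⟨s, t⟩ ⟨⟨hs, hsb⟩, ht⟩
      obtain ⟨w, hw, hwΦ⟩ := hball s hsb t ht
      rw [← hFΦ s hs t] at hwΦ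
      rw [Metric.mem_ball, dist_eq_norm] at hw
      rcases (pillowProj_eq_iff _ _).1 hwΦ with h | h
      · refine ⟨p + (F (s, t) - w), ?_, ?_⟩
        · rw [pillowProj_eq_iff]
          left
          simpa using lattesLattice.neg_mem h
        · rw [Metric.mem_ball, dist_eq_norm]
          convert hw using 2
          ring
      · refine ⟨-p + (F (s, t) + w), ?_, ?_⟩
        · rw [pillowProj_eq_iff]
          right
          simpa using h
        · rw [Metric.mem_ball, dist_eq_norm, ← norm_neg]
          have e : -(F (s, t) - (-p + (F (s, t) + w))) = w - p := by ring
          rwa [e]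
    have hmem : S ∩ Metric.ball s₀ δ ∈ 𝓝[S] s₀ :=
      inter_mem_nhdsWithin S (Metric.ball_mem_nhds s₀ hδ)
    obtain ⟨s₁, hs₁⟩ := Filter.nonempty_of_mem hmem
    have hx₁ : (s₁, (0 : ℝ)) ∈ (S ∩ Metric.ball s₀ δ) ×ˢ Set.Icc (0 : ℝ) 1 :=
      ⟨hs₁, by simp⟩
    obtain ⟨q, hq, hFq⟩ := hcov _ hx₁
    have hsub := hFK.subset_left_of_subset_union (u := Metric.ball q r)
      (v := ⋃ q' ∈ {q' | pillowProj q' = pillowProj p ∧ q' ≠ q}, Metric.ball q' r)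
      Metric.isOpen_ball (isOpen_biUnion fun _ _ => Metric.isOpen_ball) (by
        rw [Set.disjoint_left]
        intro z hz hz'
        simp only [Set.mem_iUnion, exists_prop] at hz'
        obtain ⟨q', ⟨hq', hne⟩, hz'⟩ := hz'
        refine hne (eq_of_pillowProj_eq_of_norm_lt (hq' ▸ hP) (hq ▸ hP) ?_)
        rw [Metric.mem_ball, dist_comm] at hz'
        rw [Metric.mem_ball] at hz
        rw [← dist_eq_norm]
        have := dist_triangle q' z q
        norm_num at hr4 ⊢
        linarith) (by
        rintro _ ⟨x, hx, rfl⟩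
        obtain ⟨q', hq', hFq'⟩ := hcov x hx
        by_cases hne : q' = q
        · exact Or.inl (hne ▸ hFq')
        · exact Or.inr (Set.mem_biUnion
            (show q' ∈ {q' | pillowProj q' = pillowProj p ∧ q' ≠ q} from ⟨hq', hne⟩) hFq'))
      ⟨F (s₁, 0), Set.mem_image_of_mem F hx₁, hFq⟩
    exact ⟨q, hq, Filter.mem_of_superset hmem fun s hs t ht =>
      hsub (Set.mem_image_of_mem F ⟨hs, ht⟩)⟩
  obtain ⟨q, hq, hqF⟩ := main 4⁻¹ (by norm_num) le_rfl
  refine ⟨q, hq, fun t ht => Metric.tendsto_nhds.2 fun ε hε => ?_⟩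
  obtain ⟨q', hq', hqF'⟩ := main (min ε 4⁻¹) (by positivity) (min_le_right _ _)
  have hqq : q' = q := by
    obtain ⟨s, hs, hs'⟩ := (hqF.and hqF').exists
    have h1 := Metric.mem_ball.1 (hs t ht)
    have h2 := Metric.mem_ball.1 (hs' t ht)
    rw [dist_comm] at h2
    refine eq_of_pillowProj_eq_of_norm_lt (hq' ▸ hP) (hq ▸ hP) ?_
    rw [← dist_eq_norm]
    have := dist_triangle q' (F (s, t)) q
    have := min_le_right ε (4⁻¹ : ℝ)
    norm_num at *
    linarith
  filter_upwards [hqF'] with s hs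
  rw [← hqq]
  exact (Metric.mem_ball.1 (hs t ht)).trans_le (min_le_left _ _)

/-- A homotopy of paths between cone points that avoids the cone points in between: the initial and
the final path have lifts with the same end points. -/
theorem exists_lift_homotopy {a b : ℝ} (hab : a < b) {Φ : ℝ × ℝ → Pillow} (hΦ : Continuous Φ)
    (hreg : ∀ s ∈ Set.Ioo a b, ∀ t, Φ (s, t) ∉ postSet lattesMap) {P Q : Pillow}
    (hP : P ∈ postSet lattesMap) (hQ : Q ∈ postSet lattesMap)
    (ha : ∀ t ∈ Set.Icc (0 : ℝ) 1, Φ (a, t) = P) (hb : ∀ t ∈ Set.Icc (0 : ℝ) 1, Φ (b, t) = Q) :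
    ∃ α β : ℝ → ℂ, ContinuousOn α (Set.Icc a b) ∧ ContinuousOn β (Set.Icc a b) ∧
      (∀ s ∈ Set.Icc a b, pillowProj (α s) = Φ (s, 0)) ∧
      (∀ s ∈ Set.Icc a b, pillowProj (β s) = Φ (s, 1)) ∧ α a = β a ∧ α b = β b := by
  obtain ⟨F, hF, hFΦ⟩ := exists_lift_strip hab hΦ hreg
  have hna : (𝓝[Set.Ioo a b] a).NeBot := by
    rw [nhdsWithin_Ioo_eq_nhdsGT hab]
    infer_instance
  have hnb : (𝓝[Set.Ioo a b] b).NeBot := by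
    rw [nhdsWithin_Ioo_eq_nhdsLT hab]
    infer_instance
  obtain ⟨p, hp, hpF⟩ := exists_tendsto_lift Set.ordConnected_Ioo hΦ hF hFΦ hP ha
  obtain ⟨q, hq, hqF⟩ := exists_tendsto_lift Set.ordConnected_Ioo hΦ hF hFΦ hQ hb
  rw [nhdsWithin_Ioo_eq_nhdsGT hab] at hpF
  rw [nhdsWithin_Ioo_eq_nhdsLT hab] at hqF
  have key : ∀ t ∈ Set.Icc (0 : ℝ) 1, ∃ α : ℝ → ℂ, ContinuousOn α (Set.Icc a b) ∧
      (∀ s ∈ Set.Icc a b, pillowProj (α s) = Φ (s, t)) ∧ α a = p ∧ α b = q := by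
    intro t ht
    have hc : ContinuousOn (fun s => F (s, t)) (Set.Ioo a b) :=
      hF.comp (by fun_prop) fun s hs => ⟨hs, trivial⟩
    have ea := eq_lim_at_left_extendFrom_Ioo hab (hpF t ht)
    have eb := eq_lim_at_right_extendFrom_Ioo hab (hqF t ht)
    refine ⟨extendFrom (Set.Ioo a b) fun s => F (s, t),
      continuousOn_Icc_extendFrom_Ioo hc (hpF t ht) (hqF t ht), fun s hs => ?_, ea, eb⟩
    rcases Set.eq_endpoints_or_mem_Ioo_of_mem_Icc hs with rfl | rfl | hs
    · rw [ea, hp, ha t ht]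
    · rw [eb, hq, hb t ht]
    · rw [extendFrom_eq (subset_closure hs) (hc s hs)]
      exact hFΦ s hs t
  obtain ⟨α, hα, hα', hαa, hαb⟩ := key 0 (by simp)
  obtain ⟨β, hβ, hβ', hβa, hβb⟩ := key 1 (by simp)
  exact ⟨α, β, hα, hβ, hα', hβ', hαa.trans hβa.symm, hαb.trans hβb.symm⟩

theorem isDiscrete_lattesLattice : IsDiscrete (lattesLattice : Set ℂ) :=
  ⟨DiscreteTopology.of_forall_le_dist one_pos fun l m hlm => by
    by_contra! h
    rw [Subtype.dist_eq, dist_eq_norm] at h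
    exact hlm (Subtype.ext (sub_eq_zero.1
      (eq_zero_of_mem_lattesLattice (lattesLattice.sub_mem l.2 m.2) h)))⟩

theorem eq_of_continuousOn_of_mem_lattesLattice {a b : ℝ} (hab : a < b) {f : ℝ → ℂ}
    (hf : ContinuousOn f (Set.Icc a b)) (hL : ∀ s ∈ Set.Icc a b, f s ∈ lattesLattice) :
    f a = f b :=
  isPreconnected_Icc.constant_of_mapsTo isDiscrete_lattesLattice hf hL
    (Set.left_mem_Icc.2 hab.le) (Set.right_mem_Icc.2 hab.le)

/-- Lifts of a path that avoids the cone points in its interior are unique up to the maps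
`z ↦ ± z + l`. In particular their displacements agree up to sign. -/
theorem displacement_eq_or_eq_neg {a b : ℝ} (hab : a < b) {α β : ℝ → ℂ}
    (hα : ContinuousOn α (Set.Icc a b)) (hβ : ContinuousOn β (Set.Icc a b))
    (h : ∀ s ∈ Set.Icc a b, pillowProj (α s) = pillowProj (β s))
    (hreg : ∀ s ∈ Set.Ioo a b, pillowProj (α s) ∉ postSet lattesMap) :
    β b - β a = α b - α a ∨ β b - β a = -(α b - α a) := by
  have hm : ContinuousOn (fun s => β s - α s) (Set.Icc a b) := hβ.sub hα
  have hp : ContinuousOn (fun s => β s + α s) (Set.Icc a b) := hβ.add hα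
  have hmc := hm.preimage_isClosed_of_isClosed isClosed_Icc isClosed_lattesLattice
  have hpc := hp.preimage_isClosed_of_isClosed isClosed_Icc isClosed_lattesLattice
  have hor := isPreconnected_iff_subset_of_disjoint_closed.1
    (isPreconnected_Ioo (a := a) (b := b)) _ _ hmc hpc (by
      intro s hs
      have hs' := Set.Ioo_subset_Icc_self hs
      rcases (pillowProj_eq_iff _ _).1 (h s hs') with hs1 | hs1
      · exact Or.inl ⟨hs', hs1⟩
      · exact Or.inr ⟨hs', hs1⟩) (by
      rw [Set.eq_empty_iff_forall_notMem]
      rintro s ⟨hs, ⟨-, h1⟩, -, h2⟩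
      refine hreg s hs (pillowProj_mem_postSet.2 ?_)
      convert lattesLattice.sub_mem h2 h1 using 1
      ring)
  rcases hor with hs | hs
  · left
    have := closure_minimal hs hmc
    rw [closure_Ioo hab.ne] at this
    have := eq_of_continuousOn_of_mem_lattesLattice hab hm fun s hs => (this hs).2
    linear_combination -this
  · right
    have := closure_minimal hs hpc
    rw [closure_Ioo hab.ne] at this
    have := eq_of_continuousOn_of_mem_lattesLattice hab hp fun s hs => (this hs).2
    linear_combination -this

/-- A path in an arc is a reparametrization of the arc. -/
theorem exists_reparametrization {X : Type*} [TopologicalSpace X] [T2Space X] {γ δ : ℝ → X}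
    {a b c d : ℝ} (hγ : ContinuousOn γ (Set.Icc a b)) (hinj : Set.InjOn γ (Set.Icc a b))
    (hδ : ContinuousOn δ (Set.Icc c d)) (hmaps : Set.MapsTo δ (Set.Icc c d) (γ '' Set.Icc a b)) :
    ∃ θ : ℝ → ℝ, ContinuousOn θ (Set.Icc c d) ∧
      ∀ s ∈ Set.Icc c d, θ s ∈ Set.Icc a b ∧ γ (θ s) = δ s := by
  have hemb : IsClosedEmbedding ((Set.Icc a b).domRestrict γ) :=
    (continuousOn_iff_continuous_domRestrict.1 hγ).isClosedEmbedding hinj.injective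
  have hmaps' : ∀ s, ∃ t, s ∈ Set.Icc c d → t ∈ Set.Icc a b ∧ γ t = δ s := fun s => by
    by_cases hs : s ∈ Set.Icc c d
    · obtain ⟨t, ht⟩ := hmaps hs
      exact ⟨t, fun _ => ht⟩
    · exact ⟨0, fun h => absurd h hs⟩
  choose θ hθ using hmaps'
  refine ⟨θ, ?_, hθ⟩
  rw [continuousOn_iff_continuous_domRestrict] at hδ ⊢
  have : Continuous fun s : Set.Icc c d => (⟨θ s, (hθ s s.2).1⟩ : Set.Icc a b) := by
    rw [hemb.isInducing.continuous_iff]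
    convert hδ using 1
    ext s
    exact (hθ s s.2).2
  exact continuous_subtype_val.comp this

/-- A lift of a path that runs through an arc has, up to sign, the displacement of any lift of the
arc. -/
theorem displacement_of_traverse {a b c d : ℝ} (hcd : c < d) {γ : ℝ → Pillow} {α β : ℝ → ℂ}
    (hγ : ContinuousOn γ (Set.Icc a b)) (hinj : Set.InjOn γ (Set.Icc a b))
    (hab : a ≤ b) (hα : ContinuousOn α (Set.Icc a b))
    (hαγ : ∀ s ∈ Set.Icc a b, pillowProj (α s) = γ s) (hβ : ContinuousOn β (Set.Icc c d))
    (hβγ : ∀ s ∈ Set.Icc c d, pillowProj (β s) ∈ γ '' Set.Icc a b)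
    (hβc : pillowProj (β c) = γ a) (hβd : pillowProj (β d) = γ b)
    (hreg : ∀ s ∈ Set.Ioo c d, pillowProj (β s) ∉ postSet lattesMap) :
    β d - β c = α b - α a ∨ β d - β c = -(α b - α a) := by
  obtain ⟨θ, hθ, hθ'⟩ := exists_reparametrization hγ hinj
    (continuous_pillowProj.comp_continuousOn hβ) hβγ
  have hc : c ∈ Set.Icc c d := Set.left_mem_Icc.2 hcd.le
  have hd : d ∈ Set.Icc c d := Set.right_mem_Icc.2 hcd.le
  have hθc : θ c = a :=
    hinj (hθ' c hc).1 (Set.left_mem_Icc.2 hab) ((hθ' c hc).2.trans hβc)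
  have hθd : θ d = b :=
    hinj (hθ' d hd).1 (Set.right_mem_Icc.2 hab) ((hθ' d hd).2.trans hβd)
  have hlift : ∀ s ∈ Set.Icc c d, pillowProj (α (θ s)) = pillowProj (β s) := fun s hs =>
    (hαγ _ (hθ' s hs).1).trans (hθ' s hs).2
  have := displacement_eq_or_eq_neg hcd (hα.comp hθ fun s hs => (hθ' s hs).1) hβ hlift
    (fun s hs => by
      rw [Function.comp_apply, hlift s (Set.Ioo_subset_Icc_self hs)]
      exact hreg s hs)
  simpa [hθc, hθd] using this

/-! ### Arithmetic of the displacement vectors -/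

/-- `z = ± u ± v` for some choice of the signs. -/
def IsSignedSum (z u v : ℂ) : Prop := z = u + v ∨ z = u - v ∨ z = -u + v ∨ z = -u - v

theorem isSignedSum_of_eq_or_eq_neg {p q u v : ℂ} (hp : p = u ∨ p = -u) (hq : q = v ∨ q = -v) :
    IsSignedSum (p + q) u v := by
  rcases hp with rfl | rfl <;> rcases hq with rfl | rfl
  · exact Or.inl rfl
  · exact Or.inr (Or.inl (sub_eq_add_neg _ _).symm)
  · exact Or.inr (Or.inr (Or.inl rfl))
  · exact Or.inr (Or.inr (Or.inr (sub_eq_add_neg _ _).symm))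

theorem isSignedSum_halfPoint {x y x₁ y₁ x₂ y₂ : ℤ} :
    IsSignedSum (lattesLift (halfPoint x y)) (halfPoint x₁ y₁) (halfPoint x₂ y₂) ↔
      (-2 * y = x₁ + x₂ ∧ x = y₁ + y₂) ∨ (-2 * y = x₁ - x₂ ∧ x = y₁ - y₂) ∨
      (-2 * y = -x₁ + x₂ ∧ x = -y₁ + y₂) ∨ (-2 * y = -x₁ - x₂ ∧ x = -y₁ - y₂) := by
  simp only [IsSignedSum, lattesLift_halfPoint, halfPoint_add, halfPoint_sub, halfPoint_neg,
    halfPoint_inj]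

/-- The displacement vectors of the four edges of the curve cannot satisfy the relations that the
circuit of `1`-edges forces on them. In the basis `√2 / 2`, `i` of the half lattice this is a
system of linear equations over `ℤ` for each choice of the signs. -/
theorem not_isSignedSum_halfPoint {x₀ y₀ x₁ y₁ x₂ y₂ x₃ y₃ : ℤ}
    (h₀ : IsSignedSum (lattesLift (halfPoint x₀ y₀)) (halfPoint x₀ y₀) (halfPoint x₁ y₁))
    (h₁ : IsSignedSum (lattesLift (halfPoint x₁ y₁)) (halfPoint x₂ y₂) (halfPoint x₃ y₃))
    (h₂ : IsSignedSum (lattesLift (halfPoint x₂ y₂)) (halfPoint x₀ y₀) (halfPoint x₁ y₁))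
    (h₃ : IsSignedSum (lattesLift (halfPoint x₃ y₃)) (halfPoint x₂ y₂) (halfPoint x₃ y₃))
    (hx : Odd x₀) (hy : Odd (y₀ - y₃)) : False := by
  rw [isSignedSum_halfPoint] at h₀ h₁ h₂ h₃
  obtain ⟨r, rfl⟩ := hx
  obtain ⟨s, hs⟩ := hy
  rcases h₀ with h₀ | h₀ | h₀ | h₀ <;> rcases h₂ with h₂ | h₂ | h₂ | h₂ <;>
    rcases h₁ with h₁ | h₁ | h₁ | h₁ <;> rcases h₃ with h₃ | h₃ | h₃ | h₃ <;> omega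

/-! ### Subdivisions of the circle -/

theorem apply_add_mul_of_periodic {N : ℕ} {w : ℤ → ℝ} (hper : ∀ j, w (j + N) = w j + 1)
    (j q : ℤ) : w (j + N * q) = w j + q := by
  induction q using Int.induction_on with
  | zero => simp
  | succ q ih =>
    rw [mul_add, mul_one, ← add_assoc, hper, ih]
    push_cast
    ring
  | pred q ih =>
    have := hper (j + N * (-(q : ℤ) - 1))
    rw [show j + (N : ℤ) * (-(q : ℤ) - 1) + N = j + N * -(q : ℤ) by ring, ih] at this
    push_cast at this ⊢
    linarith

theorem exists_mem_Ico_of_periodic {N : ℕ} [NeZero N] {w : ℤ → ℝ} (hw : StrictMono w)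
    (hper : ∀ j, w (j + N) = w j + 1) (t : ℝ) : ∃ j, w j ≤ t ∧ t < w (j + 1) := by
  have hb := apply_add_mul_of_periodic hper 0
  obtain ⟨j, hj, hmax⟩ := Int.exists_greatest_of_bdd (P := fun j => w j ≤ t)
    ⟨0 + N * ⌈t - w 0⌉, fun z hz => by
      rw [← hw.le_iff_le, hb]
      linarith [Int.le_ceil (t - w 0)]⟩
    ⟨0 + N * ⌊t - w 0⌋, by
      rw [hb]
      linarith [Int.floor_le (t - w 0)]⟩
  refine ⟨j, hj, not_le.1 fun h => ?_⟩
  have := hmax _ h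
  omega

theorem coe_eq_coe_iff_of_periodic {N : ℕ} {w : ℤ → ℝ} (hw : StrictMono w)
    (hper : ∀ j, w (j + N) = w j + 1) {i j : ℤ} :
    (w i : AddCircle (1 : ℝ)) = (w j : AddCircle (1 : ℝ)) ↔ (N : ℤ) ∣ i - j := by
  rw [← sub_eq_zero, ← AddCircle.coe_sub, AddCircle.coe_eq_zero_iff]
  constructor
  · rintro ⟨q, hq⟩
    refine ⟨q, ?_⟩
    have : w i = w (j + N * q) := by
      rw [apply_add_mul_of_periodic hper]
      simp at hq
      linarith
    have := hw.injective this
    linarith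
  · rintro ⟨q, hq⟩
    refine ⟨q, ?_⟩
    rw [show i = j + N * q by linarith, apply_add_mul_of_periodic hper]
    simp

/-- A curve that traverses a circuit meets the vertices only at the division points. -/
theorem exists_eq_of_mem_vertexSet {S : Type*} [TopologicalSpace S] {f : S → S} {C : Set S}
    {n N : ℕ} [NeZero N] {g : AddCircle (1 : ℝ) → S} {γ : ZMod N → OrientedEdge f C n} {w : ℤ → ℝ}
    (hw : StrictMono w) (hper : ∀ j, w (j + N) = w j + 1)
    (hwγ : ∀ j : ℤ,
      Set.InjOn (fun t : ℝ => g (t : AddCircle (1 : ℝ))) (Set.Icc (w j) (w (j + 1))) ∧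
      (fun t : ℝ => g (t : AddCircle (1 : ℝ))) '' Set.Icc (w j) (w (j + 1)) =
        (γ (j : ZMod N)).carrier ∧
      g (w j : AddCircle (1 : ℝ)) = (γ (j : ZMod N)).init ∧
      g (w (j + 1) : AddCircle (1 : ℝ)) = (γ (j : ZMod N)).term)
    {t : ℝ} (ht : g (t : AddCircle (1 : ℝ)) ∈ vertexSet f n) : ∃ j, t = w j := by
  obtain ⟨j, hj, hj'⟩ := exists_mem_Ico_of_periodic hw hper t
  obtain ⟨hinj, himg, hi, he⟩ := hwγ j
  have htI : t ∈ Set.Icc (w j) (w (j + 1)) := ⟨hj, hj'.le⟩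
  have hlt := hw (lt_add_one j)
  have hmem : g (t : AddCircle (1 : ℝ)) ∈ (γ (j : ZMod N)).carrier ∩ vertexSet f n :=
    ⟨himg ▸ ⟨t, htI, rfl⟩, ht⟩
  rw [(γ (j : ZMod N)).endpoints, ← hi, ← he] at hmem
  rcases hmem with h | h
  · exact ⟨j, hinj htI (Set.left_mem_Icc.2 hlt.le) h⟩
  · exact ⟨j + 1, hinj htI (Set.right_mem_Icc.2 hlt.le) h⟩

/-! ### The cyclic order of the postcritical points -/

theorem conePoint_eq_standard (x y : ℤ) : conePoint x y = conePoint 0 0 ∨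
    conePoint x y = conePoint 0 1 ∨ conePoint x y = conePoint 1 0 ∨
    conePoint x y = conePoint 1 1 := by
  simp only [conePoint_eq_iff, Int.even_iff]
  omega

theorem natCard_postSet : Nat.card (postSet lattesMap) = 4 := by
  let c : Fin 2 × Fin 2 → Pillow := fun i => conePoint (i.1 : ℕ) (i.2 : ℕ)
  have hc : Function.Injective c := by
    rintro ⟨i, j⟩ ⟨i', j'⟩ h
    simp only [c, conePoint_eq_iff, Int.even_iff] at h
    ext <;> simp only <;> omega
  have hr : Set.range c = postSet lattesMap := by
    rw [postSet_lattesMap]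
    ext p
    constructor
    · rintro ⟨i, rfl⟩
      exact ⟨_, _, rfl⟩
    · rintro ⟨x, y, rfl⟩
      rcases conePoint_eq_standard x y with h | h | h | h <;> rw [h]
      exacts [⟨(0, 0), rfl⟩, ⟨(0, 1), rfl⟩, ⟨(1, 0), rfl⟩, ⟨(1, 1), rfl⟩]
  rw [← hr, Nat.card_range_of_injective hc]
  simp

/-- Let `x j` be the postcritical points in their order on the curve, and let `k j` be the
position of `x j` in the circuit that covers the curve twice. Then the points `0` and `i` are
opposite to each other on the curve, and two consecutive postcritical points are always separated
by one vertex of the circuit. -/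
theorem cyclic_order {x : ℤ → Pillow} (hx : ∀ i j, x i = x j ↔ (4 : ℤ) ∣ i - j)
    (hsurj : ∀ p ∈ postSet lattesMap, ∃ j, x j = p) {k : ℤ → ℤ} (hk : StrictMono k)
    (hk4 : ∀ j, k (j + 4) = k j + 8) {m : ℤ} (hm : ∀ j, lattesMap (x j) = x (m + k j)) :
    ∃ j₀, x j₀ = conePoint 0 0 ∧ x (j₀ + 2) = conePoint 0 1 ∧
      (x (j₀ + 1) = conePoint 1 0 ∧ x (j₀ + 3) = conePoint 1 1 ∨
        x (j₀ + 1) = conePoint 1 1 ∧ x (j₀ + 3) = conePoint 1 0) ∧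
      (4 : ℤ) ∣ m + k j₀ - j₀ ∧ ∀ j, k j = k j₀ + 2 * (j - j₀) := by
  have hpost : ∀ a b, conePoint a b ∈ postSet lattesMap := fun a b => by
    rw [postSet_lattesMap]
    exact ⟨a, b, rfl⟩
  obtain ⟨j₀, h0⟩ := hsurj _ (hpost 0 0)
  have hpos : ∀ a b, ∃ r : ℤ, 0 ≤ r ∧ r < 4 ∧ x (j₀ + r) = conePoint a b := by
    intro a b
    obtain ⟨j, hj⟩ := hsurj _ (hpost a b)
    refine ⟨(j - j₀) % 4, by omega, by omega, ?_⟩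
    rw [← hj, hx]
    omega
  obtain ⟨r, hr0, hr4, hr⟩ := hpos 0 1
  obtain ⟨s, hs0, hs4, hs⟩ := hpos 1 0
  obtain ⟨t, ht0, ht4, ht⟩ := hpos 1 1
  have hne : ∀ {i j : ℤ} {a b c d : ℤ}, x i = conePoint a b → x j = conePoint c d →
      ¬ (Even (c - a) ∧ Even (d - b)) → i ≠ j := by
    rintro i j a b c d h1 h2 h3 rfl
    exact h3 (conePoint_eq_iff.1 (h1.symm.trans h2))
  have n1 := hne h0 hr (by decide)
  have n2 := hne h0 hs (by decide)
  have n3 := hne h0 ht (by decide)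
  have n4 := hne hr hs (by decide)
  have n5 := hne hr ht (by decide)
  have n6 := hne hs ht (by decide)
  have d0 : (4 : ℤ) ∣ m + k j₀ - j₀ := by
    rw [← hx, ← hm, h0, lattesMap_conePoint]
  have d1 : (4 : ℤ) ∣ m + k (j₀ + r) - j₀ := by
    rw [← hx, ← hm, h0, hr, lattesMap_conePoint]
  have d2 : (4 : ℤ) ∣ m + k (j₀ + s) - (j₀ + r) := by
    rw [← hx, ← hm, hr, hs, lattesMap_conePoint]
  have d3 : (4 : ℤ) ∣ m + k (j₀ + t) - (j₀ + r) := by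
    rw [← hx, ← hm, hr, ht, lattesMap_conePoint]
  have l1 : k j₀ < k (j₀ + 1) := hk (by omega)
  have l2 : k (j₀ + 1) < k (j₀ + 2) := hk (by omega)
  have l3 : k (j₀ + 2) < k (j₀ + 3) := hk (by omega)
  have l4 : k (j₀ + 3) < k j₀ + 8 := hk4 j₀ ▸ hk (by omega)
  -- the relations modulo `4` force `0` and `i` to be opposite, and all gaps to be two
  have hgap : r = 2 ∧ k (j₀ + 1) = k j₀ + 2 ∧ k (j₀ + 2) = k j₀ + 4 ∧ k (j₀ + 3) = k j₀ + 6 := by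
    interval_cases r <;> interval_cases s <;> interval_cases t <;> omega
  obtain ⟨rfl, g1, g2, g3⟩ := hgap
  refine ⟨j₀, h0, hr, ?_, d0, ?_⟩
  · obtain ⟨rfl, rfl⟩ | ⟨rfl, rfl⟩ : (s = 1 ∧ t = 3) ∨ (s = 3 ∧ t = 1) := by omega
    · exact Or.inl ⟨hs, ht⟩
    · exact Or.inr ⟨ht, hs⟩
  · have hq : ∀ i q : ℤ, k (i + 4 * q) = k i + 8 * q := by
      intro i q
      induction q using Int.induction_on with
      | zero => simp
      | succ q ih =>
        rw [mul_add, mul_one, ← add_assoc, hk4, ih]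
        ring
      | pred q ih =>
        have := hk4 (i + 4 * (-(q : ℤ) - 1))
        rw [show i + 4 * (-(q : ℤ) - 1) + 4 = i + 4 * -(q : ℤ) by ring, ih] at this
        linarith
    intro j
    obtain ⟨q, hj | hj | hj | hj⟩ : ∃ q, j = j₀ + 4 * q ∨ j = j₀ + 1 + 4 * q ∨
        j = j₀ + 2 + 4 * q ∨ j = j₀ + 3 + 4 * q := ⟨(j - j₀) / 4, by omega⟩ <;>
      rw [hj, hq] <;> linarith

/-! ### The pseudo-isotopy -/

/-- The displacement of a path between cone points is determined modulo `L` by its end points. -/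
theorem exists_sub_eq_halfPoint {z z' : ℂ} {x y x' y' : ℤ} (hz : pillowProj z = conePoint x y)
    (hz' : pillowProj z' = conePoint x' y') :
    ∃ X Y, z' - z = halfPoint X Y ∧ Even (X - (x' - x)) ∧ Even (Y - (y' - y)) := by
  obtain ⟨a, b, rfl⟩ := exists_halfPoint (pillowProj_eq_conePoint hz)
  obtain ⟨a', b', rfl⟩ := exists_halfPoint (pillowProj_eq_conePoint hz')
  replace hz := conePoint_eq_iff.1 hz
  replace hz' := conePoint_eq_iff.1 hz'
  refine ⟨_, _, halfPoint_sub _ _ _ _, ?_, ?_⟩ <;> simp only [Int.even_iff] at * <;> omega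

theorem lattesMap_mem_postSet {p : Pillow} (hp : p ∈ postSet lattesMap) :
    lattesMap p ∈ postSet lattesMap := by
  rw [postSet_lattesMap] at hp ⊢
  obtain ⟨x, y, rfl⟩ := hp
  exact ⟨_, _, lattesMap_conePoint x y⟩

theorem mem_vertexSet_one {p : Pillow} :
    p ∈ vertexSet lattesMap 1 ↔ lattesMap p ∈ postSet lattesMap := Iff.rfl

/-- A circuit traversed by an injective parametrization of a curve through all postcritical points
has four edges. -/
theorem circuit_length_eq_four {g : AddCircle (1 : ℝ) → Pillow} (hinj : Function.Injective g)
    (hpost : postSet lattesMap ⊆ Set.range g) {N : ℕ} [NeZero N] {w : ℤ → ℝ} (hw : StrictMono w)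
    (hper : ∀ j, w (j + N) = w j + 1)
    (hvert : ∀ t : ℝ, g (t : AddCircle (1 : ℝ)) ∈ postSet lattesMap ↔ ∃ j, t = w j) : N = 4 := by
  let c : Fin N → Pillow := fun i => g (w (i : ℕ) : AddCircle (1 : ℝ))
  have hc : Function.Injective c := by
    intro i j hij
    have h := (coe_eq_coe_iff_of_periodic hw hper).1 (hinj hij)
    have hi := i.2
    have hj := j.2
    have := Int.eq_zero_of_abs_lt_dvd h (by rw [abs_lt]; omega)
    ext
    omega
  have hr : Set.range c = postSet lattesMap := by
    ext p
    constructor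
    · rintro ⟨i, rfl⟩
      exact (hvert _).2 ⟨_, rfl⟩
    · intro hp
      obtain ⟨s, rfl⟩ := hpost hp
      obtain ⟨t, rfl⟩ := QuotientAddGroup.mk_surjective s
      obtain ⟨j, rfl⟩ := (hvert t).1 hp
      have hN : (0 : ℤ) < N := by exact_mod_cast NeZero.pos N
      have h0 := Int.emod_nonneg j hN.ne'
      have h1 := Int.emod_lt_of_pos j hN
      refine ⟨⟨(j % N).toNat, by omega⟩, congrArg g ((coe_eq_coe_iff_of_periodic hw hper).2 ?_)⟩
      simp only
      rw [Int.toNat_of_nonneg h0]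
      exact ⟨-(j / N), by have := Int.emod_add_mul_ediv j N; linarith⟩
  have := natCard_postSet
  rw [← hr, Nat.card_range_of_injective hc, Nat.card_fin] at this
  exact this

theorem not_isInitialPseudoIsotopy {g : AddCircle (1 : ℝ) → Pillow}
    (hinj : Function.Injective g) (hpost : postSet lattesMap ⊆ Set.range g)
    (H : Pillow → unitInterval → Pillow) : ¬ IsInitialPseudoIsotopy lattesMap 2 g H := by
  intro hH
  obtain ⟨N, γ₀, γ₁, hN, -, ⟨hg, w, hw, hwper, hwγ⟩, -, ⟨-, w', hw', hwper', hwγ'⟩, m₀, hm₀⟩ :=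
    hH.cover
  have : NeZero (2 * N) := ⟨mul_ne_zero two_ne_zero hN.out⟩
  have hmemw : ∀ j, g (w j : AddCircle (1 : ℝ)) ∈ postSet lattesMap := fun j => by
    rw [(hwγ j).2.2.1]
    exact ((γ₀ j).endpoints.symm ▸ Set.mem_insert _ _ :
      (γ₀ j).init ∈ (γ₀ j).carrier ∩ vertexSet lattesMap 0).2
  have hvert : ∀ t : ℝ, g (t : AddCircle (1 : ℝ)) ∈ postSet lattesMap ↔ ∃ j, t = w j :=
    fun t => ⟨exists_eq_of_mem_vertexSet (n := 0) hw hwper hwγ, by rintro ⟨j, rfl⟩; exact hmemw j⟩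
  obtain rfl := circuit_length_eq_four hinj hpost hw hwper hvert
  have hvert' : ∀ t : ℝ, lattesMap (H (g (t : AddCircle (1 : ℝ))) 1) ∈ postSet lattesMap →
      ∃ k, t = w' k := fun t ht =>
    exists_eq_of_mem_vertexSet (g := fun s => H (g s) 1) hw' hwper' hwγ' (mem_vertexSet_one.2 ht)
  -- `k j` is the position of the `j`-th postcritical point in the circuit of `1`-edges
  have hfix : ∀ j t, H (g (w j : AddCircle (1 : ℝ))) t = g (w j : AddCircle (1 : ℝ)) := fun j t =>
    hH.pseudoIsotopy.rel _ (hmemw j) t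
  choose k hk using fun j => hvert' (w j) (by
    rw [hfix]
    exact lattesMap_mem_postSet (hmemw j))
  have hkmono : StrictMono k := fun i j hij => by
    have := hw hij
    rwa [hk i, hk j, hw'.lt_iff_lt] at this
  have hk4 : ∀ j, k (j + 4) = k j + 8 := fun j => by
    apply hw'.injective
    have h1 := hwper j
    have h2 := hwper' (k j)
    rw [← hk j] at h2
    push_cast at h1 h2
    rw [← hk, h1, h2]
  -- the covering relation, with integer indices
  obtain ⟨m, rfl⟩ := ZMod.intCast_surjective m₀
  have hcover : ∀ i l : ℤ, (4 : ℤ) ∣ m + l - i →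
      MapsEdge (γ₁ (l : ZMod (2 * 4))) (γ₀ (i : ZMod 4)) := by
    intro i l hil
    have h := hm₀ (l % 8).toNat
    have hl : (((l % 8).toNat : ℤ)) = l % 8 := Int.toNat_of_nonneg (by omega)
    have e1 : (((l % 8).toNat : ℕ) : ZMod (2 * 4)) = (l : ZMod (2 * 4)) := by
      rw [← Int.cast_natCast, ZMod.intCast_eq_intCast_iff_dvd_sub, hl]
      push_cast
      omega
    have e2 : (m : ZMod 4) + (((l % 8).toNat : ℕ) : ZMod 4) = (i : ZMod 4) := by
      rw [← Int.cast_natCast, ← Int.cast_add, ZMod.intCast_eq_intCast_iff_dvd_sub, hl]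
      push_cast
      omega
    rwa [e1, e2] at h
  have hinit : ∀ i l : ℤ, (4 : ℤ) ∣ m + l - i →
      lattesMap (H (g (w' l : AddCircle (1 : ℝ))) 1) = g (w i : AddCircle (1 : ℝ)) := by
    intro i l hil
    have := (hcover i l hil).2.1
    rwa [← (hwγ' l).2.2.1, ← (hwγ i).2.2.1] at this
  obtain ⟨j₀, hx0, hx2, hx13, hmod, hkj⟩ := cyclic_order (x := fun j => g (w j : AddCircle (1 : ℝ)))
    (fun i j => hinj.eq_iff.trans (coe_eq_coe_iff_of_periodic hw hwper)) (by
      intro p hp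
      obtain ⟨s, rfl⟩ := hpost hp
      obtain ⟨t, rfl⟩ := QuotientAddGroup.mk_surjective s
      obtain ⟨j, rfl⟩ := (hvert t).1 hp
      exact ⟨j, rfl⟩) hkmono hk4 (m := m) (fun j => by
      have := hinit (m + k j) (k j) (by simp)
      rwa [← hk, hfix] at this)
  -- between two postcritical points of the curve, no time of the homotopy hits a cone point
  have hreg : ∀ j, ∀ s ∈ Set.Ioo (w j) (w (j + 1)), ∀ t : unitInterval,
      H (g (s : AddCircle (1 : ℝ))) t ∉ postSet lattesMap := by
    intro j s hs t hmem
    have hsw : ∀ i, s ≠ w i := by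
      rintro i rfl
      have h1 := hw.lt_iff_lt.1 hs.1
      have h2 := hw.lt_iff_lt.1 hs.2
      omega
    -- before time `1` the stages are injective and fix the cone points
    rcases lt_or_eq_of_le (show t ≤ 1 from unitInterval.le_one') with ht | rfl
    · have h1 := (hH.pseudoIsotopy.isHomeomorph t ht).injective
        (show H _ t = H _ t from (hH.pseudoIsotopy.rel _ hmem t).symm)
      rw [← h1] at hmem
      obtain ⟨i, hi⟩ := (hvert s).1 hmem
      exact hsw i hi
    · obtain ⟨l, rfl⟩ := hvert' s (lattesMap_mem_postSet hmem)
      rw [hk j, hk (j + 1), Set.mem_Ioo, hw'.lt_iff_lt, hw'.lt_iff_lt, hkj j, hkj (j + 1)] at hs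
      have hl := hinit (m + l) l (by simp)
      -- a cone point has its image in `{℘ 0, ℘ i}`, which contradicts the parity of `m + l`
      obtain ⟨i, hi⟩ : ∃ i, g (w (m + l) : AddCircle (1 : ℝ)) =
          g (w (j₀ + 2 * i) : AddCircle (1 : ℝ)) := by
        rw [← hl]
        rw [postSet_lattesMap] at hmem
        obtain ⟨x, y, hxy⟩ := hmem
        rw [hxy, lattesMap_conePoint]
        rcases Int.even_or_odd x with hx | hx
        · refine ⟨0, ?_⟩
          rw [mul_zero, add_zero, hx0, conePoint_eq_iff]
          simpa using hx
        · refine ⟨1, ?_⟩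
          rw [mul_one, hx2, conePoint_eq_iff]
          refine ⟨by simp, ?_⟩
          rw [Int.even_sub, iff_false_left (by simp)]
          simpa using hx
      have := (coe_eq_coe_iff_of_periodic hw hwper).1 (hinj hi)
      push_cast at this
      omega
  -- lifts of the edges of the curve and of their images under the end of the pseudo-isotopy
  have hlift : ∀ j, ∃ α β : ℝ → ℂ, ContinuousOn α (Set.Icc (w j) (w (j + 1))) ∧
      ContinuousOn β (Set.Icc (w j) (w (j + 1))) ∧
      (∀ s ∈ Set.Icc (w j) (w (j + 1)), pillowProj (α s) = g (s : AddCircle (1 : ℝ))) ∧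
      (∀ s ∈ Set.Icc (w j) (w (j + 1)), pillowProj (β s) = H (g (s : AddCircle (1 : ℝ))) 1) ∧
      α (w j) = β (w j) ∧ α (w (j + 1)) = β (w (j + 1)) := by
    intro j
    have hΦ : Continuous fun x : ℝ × ℝ =>
        H (g (x.1 : AddCircle (1 : ℝ))) (Set.projIcc (0 : ℝ) 1 zero_le_one x.2) :=
      hH.pseudoIsotopy.continuous.comp₂
        (hg.comp ((AddCircle.continuous_mk' 1).comp continuous_fst))
        ((continuous_projIcc (h := zero_le_one' ℝ)).comp continuous_snd)
    obtain ⟨α, β, h1, h2, h3, h4, h5, h6⟩ := exists_lift_homotopy (hw (lt_add_one j)) hΦ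
      (fun s hs t => hreg j s hs _) (hmemw j) (hmemw (j + 1)) (fun t _ => hfix j _)
      (fun t _ => hfix (j + 1) _)
    refine ⟨α, β, h1, h2, fun s hs => ?_, fun s hs => ?_, h5, h6⟩
    · rw [h3 s hs]
      simp only [Set.projIcc_left]
      exact hH.pseudoIsotopy.zero _
    · rw [h4 s hs]
      simp only [Set.projIcc_right]
      rfl
  choose α β hα hβ hαg hβG hl hr using hlift
  -- `ψ` maps the lift of the image of an edge to a lift of two consecutive edges of the curve
  have hpiece : ∀ i l c : ℤ, (4 : ℤ) ∣ m + l - i →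
      Set.Icc (w' l) (w' (l + 1)) ⊆ Set.Icc (w c) (w (c + 1)) →
      lattesLift (β c (w' (l + 1))) - lattesLift (β c (w' l)) = α i (w (i + 1)) - α i (w i) ∨
      lattesLift (β c (w' (l + 1))) - lattesLift (β c (w' l)) =
        -(α i (w (i + 1)) - α i (w i)) := by
    intro i l c hil hsub
    have hlt := hw' (lt_add_one l)
    have hcov := hcover i l hil
    have hproj : ∀ s ∈ Set.Icc (w' l) (w' (l + 1)), pillowProj (lattesLift (β c s)) =
        lattesMap (H (g (s : AddCircle (1 : ℝ))) 1) := fun s hs => by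
      rw [← lattesMap_pillowProj, hβG c s (hsub hs)]
    refine displacement_of_traverse (β := fun s => lattesLift (β c s)) hlt
      (hg.comp (AddCircle.continuous_mk' 1)).continuousOn
      (hwγ i).1 (hw (lt_add_one i)).le (hα i) (hαg i)
      (continuous_lattesLift.comp_continuousOn ((hβ c).mono hsub)) (fun s hs => ?_) ?_ ?_
      (fun s hs => ?_)
    · rw [hproj s hs]
      refine (hwγ i).2.1.symm ▸ hcov.1 ▸ Set.mem_image_of_mem _ ?_
      exact (hwγ' l).2.1 ▸ ⟨s, hs, rfl⟩
    · rw [hproj _ (Set.left_mem_Icc.2 hlt.le)]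
      exact hinit i l hil
    · rw [hproj _ (Set.right_mem_Icc.2 hlt.le)]
      exact hinit (i + 1) (l + 1) (by omega)
    · rw [hproj s (Set.Ioo_subset_Icc_self hs)]
      intro hmem
      obtain ⟨l', rfl⟩ := hvert' s hmem
      have h1 := hw'.lt_iff_lt.1 hs.1
      have h2 := hw'.lt_iff_lt.1 hs.2
      omega
  have hsum : ∀ c i : ℤ, (4 : ℤ) ∣ m + k c - i →
      IsSignedSum (lattesLift (α c (w (c + 1)) - α c (w c))) (α i (w (i + 1)) - α i (w i))
        (α (i + 1) (w (i + 1 + 1)) - α (i + 1) (w (i + 1))) := by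
    intro c i hci
    have hk1 : k (c + 1) = k c + 1 + 1 := by rw [hkj c, hkj (c + 1)]; ring
    have h1 := hpiece i (k c) c hci (by
      rw [hk c, hk (c + 1), hk1]
      exact Set.Icc_subset_Icc_right (hw'.monotone (by omega)))
    have h2 := hpiece (i + 1) (k c + 1) c (by omega) (by
      rw [hk c, hk (c + 1), hk1]
      exact Set.Icc_subset_Icc_left (hw'.monotone (by omega)))
    rw [← hk1, ← hk] at h2
    rw [← hk] at h1
    convert isSignedSum_of_eq_or_eq_neg h1 h2 using 1
    rw [hl, hr, lattesLift_sub]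
    ring
  have hproj : ∀ i, pillowProj (α i (w i)) = g (w i : AddCircle (1 : ℝ)) := fun i =>
    hαg i _ (Set.left_mem_Icc.2 (hw (lt_add_one i)).le)
  have hproj' : ∀ i, pillowProj (α i (w (i + 1))) = g (w (i + 1) : AddCircle (1 : ℝ)) := fun i =>
    hαg i _ (Set.right_mem_Icc.2 (hw (lt_add_one i)).le)
  -- the displacements of the four edges, starting at `℘ 0`
  have hx4 : g (w (j₀ + 3 + 1) : AddCircle (1 : ℝ)) = conePoint 0 0 := by
    rw [← hx0, (coe_eq_coe_iff_of_periodic hw hwper).2]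
    exact ⟨1, by push_cast; ring⟩
  have s0 := hsum j₀ j₀ hmod
  have s1 := hsum (j₀ + 1) (j₀ + 2) (by rw [hkj]; omega)
  have s2 := hsum (j₀ + 2) j₀ (by rw [hkj]; omega)
  have s3 := hsum (j₀ + 3) (j₀ + 2) (by rw [hkj]; omega)
  have a1 : j₀ + 1 + 1 = j₀ + 2 := by ring
  have a2 : j₀ + 2 + 1 = j₀ + 3 := by ring
  have d0 := hproj j₀
  have d0' := hproj' j₀
  have d1 := hproj (j₀ + 1)
  have d1' := hproj' (j₀ + 1)
  have d2 := hproj (j₀ + 2)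
  have d2' := hproj' (j₀ + 2)
  have d3 := hproj (j₀ + 3)
  have d3' := hproj' (j₀ + 3)
  simp only [a1, a2] at s0 s1 s2 s3 d0' d1' d2'
  rw [hx0] at d0
  rw [hx2] at d1' d2
  rw [hx4] at d3'
  rcases hx13 with ⟨hx1, hx3⟩ | ⟨hx1, hx3⟩
  all_goals
    rw [hx1] at d0' d1
    rw [hx3] at d2' d3
    obtain ⟨X0, Y0, e0, p0, q0⟩ := exists_sub_eq_halfPoint d0 d0'
    obtain ⟨X1, Y1, e1, -, -⟩ := exists_sub_eq_halfPoint d1 d1'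
    obtain ⟨X2, Y2, e2, -, -⟩ := exists_sub_eq_halfPoint d2 d2'
    obtain ⟨X3, Y3, e3, p3, q3⟩ := exists_sub_eq_halfPoint d3 d3'
    rw [e0, e1] at s0
    rw [e1, e2, e3] at s1
    rw [e2, e0, e1] at s2
    rw [e3, e2] at s3
    simp only [Int.even_iff] at p0 q0 p3 q3
    exact not_isSignedSum_halfPoint s0 s1 s2 s3 (Int.odd_iff.2 (by omega))
      (Int.odd_iff.2 (by omega))

theorem mainTheorem5 (g : AddCircle (1 : ℝ) → Pillow) (hg : Continuous g)
    (hinj : Function.Injective g) (hpost : postSet lattesMap ⊆ Set.range g) :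
    (∀ (N : ℕ) [NeZero N] (γ₀ : ZMod N → OrientedEdge lattesMap (Set.range g) 0)
      (γ₁ : ZMod (2 * N) → OrientedEdge lattesMap (Set.range g) 1),
      IsEulerianCircuit γ₀ → Traverses g γ₀ → IsEulerianCircuit γ₁ → IsFoldCover 2 γ₁ γ₀ →
      ¬ ∃ H : Pillow → unitInterval → Pillow,
        IsInitialPseudoIsotopy lattesMap 2 g H ∧ Traverses (fun s => H (g s) 1) γ₁) ∧
    ¬ ∃ H : Pillow → unitInterval → Pillow, IsInitialPseudoIsotopy lattesMap 2 g H :=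
  ⟨fun _ _ _ _ _ _ _ _ ⟨H, hH, _⟩ => not_isInitialPseudoIsotopy hinj hpost H hH,
    fun ⟨H, hH⟩ => not_isInitialPseudoIsotopy hinj hpost H hH⟩
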